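/- Let $\sigma$ be a positive measure on $(0,\infty)$ with $\int\tau^2\,\sigma(d\tau)<\infty$ and $\langle\tau\rangle_\sigma:=\int\tau\,\sigma(d\tau)<\infty$. Let $\mathcal D=C_0^\infty(\mathbb R^2)$ be the space of real test functions, $\mathcal D'$ its dual, equipped with the cylinder $\sigma$-algebra, and let $\nu$ be the centered Lévy noise measure with Lévy measure $\sigma$, i.e. the probability measure on $\mathcal D'$ with $$\int_{\mathcal D'}e^{i\langle\omega,\varphi\rangle}\,\nu(d\omega)=\exp\Big[\int_{\mathbb R^2}\int_{(0,\infty)}\big(e^{i\tau\varphi(x,y)}-1-i\tau\varphi(x,y)\big)\,\sigma(d\tau)\,dx\,dy\Big],\qquad\varphi\in\mathcal D .$$ For $f\in L^2(\mathbb R^2,dx\,dy)$ let $\langle\cdot,f\rangle\in L^2(\nu)$ be the value at $f$ of the extension by continuity of the map $\mathcal D\ni\varphi\mapsto\langle\cdot,\varphi\rangle\in L^2(\nu)$. Let $\varkappa:[0,\infty)^2\to[0,\infty)$ be measurable and locally bounded, let $\mu_{s,t}$ be deterministic and continuous on $\{0\le s\le t\}$, and for $0\le s\le t$ set $$X_{s,t}=\langle\omega(x,y),\mathbf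 1_{[0,s]}(x)\mathbf 1_{[0,t]}(y)\varkappa(x,y)\rangle,\qquad F_{s,t}=\mu_{s,t}+X_{s,t},\qquad R_t=F_{t,t},$$ $$P_{s,t}=\exp\Big[-\int_s^tF_{s,u}\,du\Big],\qquad Z_{s,t}=P_{s,t}\exp\Big[-\int_0^sR_u\,du\Big],$$ the integrals in $u$ being those of $L^2(\nu)$-valued functions. Let $\mathcal F_s$ be the $\sigma$-algebra generated by the random variables $F_{u,v}$, $0\le u\le s$, $u\le v$, and the $\nu$-null events. Suppose that for each $t\ge0$ the process $\{Z_{s,t},\mathcal F_s,\ 0\le s\le t\}$ is a martingale under $\nu$, and that $$\mu_{0,t}\ \ge\ \langle\tau\rangle_\sigma\int_0^t\!\int_0^t\varkappa(x,y)\,dx\,dy,\qquad t\ge0 .$$ Then the forward rates and the spot rates are $\nu$-almost surely non-negative: $F_{s,t}\ge0$ $\nu$-a.s. for all $0\le s\le t$, and $R_t\ge0$ $\nu$-a.s. for all $t\ge0$. Moreover, the field $(F_{s,t})_{0\le s\le t}$ has a version $G$ such that, for $\nu$-almost every $\omega$, simultaneously for all $0\le s\le t$, one has $G_{s,t}(\omega)\ge0$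 and $G_{s',t'}(\omega)\to G_{s,t}(\omega)$ as $(s',t')\to(s,t)$ with $s'\ge s$, $t'\ge t$, $s'\le t'$; in particular $G_{t,t}(\omega)\ge0$ for all $t\ge0$. -/

import Mathlib

open MeasureTheory ProbabilityTheory Filter Topology Set TopologicalSpace
open scoped Distributions ENNReal

noncomputable section

namespace LevyTermStructure

/-- The space `𝒟 = C₀^∞(ℝ²)` of real test functions, with its canonical (nuclear LF) topology. -/
abbrev Test : Type := 𝓓((⊤ : Opens (ℝ × ℝ)), ℝ)

/-- The space `𝒟'` of real distributions on `ℝ²`; the pairing `⟨ω, φ⟩` is `ω φ`. -/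
abbrev Dist : Type := 𝓓'((⊤ : Opens (ℝ × ℝ)), ℝ)

/-- The cylinder σ-algebra on `𝒟'`, generated by the evaluations `ω ↦ ⟨ω, φ⟩`. -/
instance cylinder : MeasurableSpace Dist :=
  ⨆ φ : Test, MeasurableSpace.comap (fun ω : Dist => ω φ) inferInstance

/-- The Fourier transform of `ν` is that of the centered Lévy noise measure with Lévy measure `σ`
on `(0, ∞)`. -/
def IsCenteredLevyNoise (σ : Measure (Ioi (0 : ℝ))) (ν : Measure Dist) : Prop :=
  ∀ φ : Test,
    ∫ ω : Dist, Complex.exp (Complex.I * ((ω φ : ℝ) : ℂ)) ∂ν =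
      Complex.exp (∫ z : ℝ × ℝ, ∫ τ : Ioi (0 : ℝ),
        (Complex.exp (Complex.I * ((τ : ℝ) : ℂ) * ((φ z : ℝ) : ℂ)) - 1
          - Complex.I * ((τ : ℝ) : ℂ) * ((φ z : ℝ) : ℂ)) ∂σ)

/-- `Y ∈ L²(ν)` is a limit in `L²(ν)` of random variables `⟨·, φₙ⟩`, where the test functions `φₙ`
converge to `f` in `L²(ℝ², dx dy)`. -/
def IsPairing (ν : Measure Dist) (f : ℝ × ℝ → ℝ) (Y : Lp ℝ 2 ν) : Prop :=
  ∃ φ : ℕ → Test,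
    Tendsto (fun n => eLpNorm (fun z => φ n z - f z) 2 volume) atTop (𝓝 0) ∧
    Tendsto (fun n => eLpNorm (fun ω : Dist => ω (φ n) - Y ω) 2 ν) atTop (𝓝 0)

open Classical in
/-- The random variable `⟨·, f⟩ ∈ L²(ν)` for `f ∈ L²(ℝ², dx dy)`: the value at `f` of the
extension by continuity of `φ ↦ ⟨·, φ⟩`, `𝒟 → L²(ν)`. For a centered Lévy noise measure with
`∫ τ² dσ < ∞` this map is `√(∫ τ² dσ)` times an isometry for the `L²(dx dy)`-norm, so there is
exactly one `Y` with `IsPairing ν f Y`; the value `0` is never used. -/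
def pairing (ν : Measure Dist) (f : ℝ × ℝ → ℝ) : Lp ℝ 2 ν :=
  if h : ∃ Y : Lp ℝ 2 ν, IsPairing ν f Y then h.choose else 0

/-- `X_{s,t} = ⟨ω(x,y), 1_{[0,s]}(x) 1_{[0,t]}(y) ϰ(x,y)⟩`. -/
def field (ν : Measure Dist) (κ : ℝ × ℝ → ℝ) (s t : ℝ) : Lp ℝ 2 ν :=
  pairing ν ((Icc 0 s ×ˢ Icc 0 t).indicator κ)

section Rates

variable (ν : Measure Dist) [IsProbabilityMeasure ν] (κ : ℝ × ℝ → ℝ) (μ : ℝ → ℝ → ℝ)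

/-- The forward rate `F_{s,t} = μ_{s,t} + X_{s,t}`, an element of `L²(ν)`. -/
def forwardRate (s t : ℝ) : Lp ℝ 2 ν := Lp.const 2 ν (μ s t) + field ν κ s t

/-- The spot rate `R_t = F_{t,t}`. -/
def spotRate (t : ℝ) : Lp ℝ 2 ν := forwardRate ν κ μ t t

/-- The bond price `P_{s,t} = exp (-∫_s^t F_{s,u} du)`; the integral is that of an
`L²(ν)`-valued function of `u`. -/
def bondPrice (s t : ℝ) (ω : Dist) : ℝ :=
  Real.exp (-((∫ u in s..t, forwardRate ν κ μ s u : Lp ℝ 2 ν) : Dist → ℝ) ω)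

/-- The discounted bond price `Z_{s,t} = P_{s,t} exp (-∫_0^s R_u du)`. -/
def discountedBondPrice (s t : ℝ) (ω : Dist) : ℝ :=
  bondPrice ν κ μ s t ω *
    Real.exp (-((∫ u in (0 : ℝ)..s, spotRate ν κ μ u : Lp ℝ 2 ν) : Dist → ℝ) ω)

/-- The σ-algebra generated by the random variables `F_{u,v}`, `0 ≤ u ≤ s`, `u ≤ v`. As these are
defined up to `ν`-null sets only, the `ν`-null events are adjoined. -/
@[reducible] def information (s : ℝ) : MeasurableSpace Dist :=
  MeasurableSpace.generateFrom
    ({A | MeasurableSet A ∧ ν A = 0} ∪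
      {A | ∃ u v : ℝ, 0 ≤ u ∧ u ≤ s ∧ u ≤ v ∧ ∃ B : Set ℝ, MeasurableSet B ∧
        A = (forwardRate ν κ μ u v : Dist → ℝ) ⁻¹' B})

/-- The filtration of the above σ-algebras, `0 ≤ s ≤ t`. -/
def informationFiltration (t : ℝ) : Filtration (Icc (0 : ℝ) t) cylinder where
  seq s := information ν κ μ s
  mono' := by
    intro s s' h
    refine MeasurableSpace.generateFrom_mono (union_subset_union_right _ ?_)
    rintro A ⟨u, v, hu, hus, huv, B, hB, rfl⟩
    exact ⟨u, v, hu, hus.trans h, huv, B, hB, rfl⟩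
  le' s := by
    refine MeasurableSpace.generateFrom_le ?_
    rintro A (⟨hA, -⟩ | ⟨u, v, -, -, -, B, hB, rfl⟩)
    · exact hA
    · exact (Lp.stronglyMeasurable (forwardRate ν κ μ u v)).measurable hB

end Rates

end LevyTermStructure

end

/-!
The random field `X_{s,t} + ⟨τ⟩_σ ∫_0^s ∫_0^t ϰ` is the pairing of the nonnegative kernel
`f_{s,t} = 1_{[0,s]}(x) 1_{[0,t]}(y) ϰ(x,y)` with the *uncompensated* noise, which is a sum of
positive jumps; so it is nonnegative and increasing in `(s, t)`. Hence the forward rates are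
nonnegative as soon as `μ_{s,t} ≥ ⟨τ⟩_σ ∫_0^s ∫_0^t ϰ`, and by the condition on the initial term
structure this follows from `μ_{s,t} ≥ μ_{0,t}` (`initial_le_mean`).

That inequality is all that is needed of the martingale property, and it needs no formula for the
drift. Up to a deterministic factor, `Z_{s,t} = exp (-⟨ω, h_{s,t}⟩)` with
`h_{s,t} = ∫_s^t f_{s,u} du + ∫_0^s f_{u,u} du`, an `L²(ℝ²)`-valued integral which is increasing in
`t`, and constancy of the expectation gives
`E exp (-⟨ω, h_{s,t}⟩) = exp (M_{s,t} - M_{0,t})`, `M` being the deterministic exponent. The Laplace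
transform `E exp (-⟨ω, h⟩) = exp (∫∫ (e^{-τh} - 1 + τh) dσ dz)` increases with `h ≥ 0`
(`integral_exp_neg_pairing_mono`), so `∫_t^{t'} (μ_{s,u} - μ_{0,u}) du ≥ 0` for all
`s ≤ t ≤ t'`, and continuity of `μ` concludes.

Both the positivity of the uncompensated pairing and its Laplace transform have to be extracted from
the characteristic function (`ae_nonneg_and_laplace_of_charFun`): the law with characteristic
function `exp ∫ (e^{iθh} - 1) dm` is, by Lévy's continuity theorem, the weak limit of convolution
powers of explicit laws on `[0, ∞)`, for which both statements are elementary. The extension of the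
noise to `L²(ℝ²)` rests on a second-moment bound, which follows from the characteristic function by
Fatou's lemma (`lintegral_sq_eval_le`); a constant worse than the sharp one is enough.

Monotonicity also yields the version: `rightInf` takes the infimum of the positive parts over
rational points to the upper right, which is right-continuous for every `ω`, and it is
a.s. equal to the original field at each point by continuity in measure (`rightInf_ae_eq`).
-/

namespace LevyTermStructure

/-! ### Laws of Poisson type on the half-line -/

/-- The `n`-fold convolution power of a measure on `ℝ`. -/
noncomputable def convPow (ρ : Measure ℝ) : ℕ → Measure ℝ
  | 0 => Measure.dirac 0
  | n + 1 => (convPow ρ n).conv ρ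

instance isProbabilityMeasure_convPow (ρ : Measure ℝ) [IsProbabilityMeasure ρ] (n : ℕ) :
    IsProbabilityMeasure (convPow ρ n) := by
  induction n with
  | zero => unfold convPow; infer_instance
  | succ n ih => unfold convPow; infer_instance

lemma ae_nonneg_convPow {ρ : Measure ℝ} [IsProbabilityMeasure ρ] (hρ : ∀ᵐ y ∂ρ, 0 ≤ y) (n : ℕ) :
    ∀ᵐ y ∂convPow ρ n, 0 ≤ y := by
  induction n with
  | zero => simp only [convPow]; rw [ae_dirac_iff measurableSet_Ici]
  | succ n ih =>
    simp only [convPow, Measure.conv]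
    rw [ae_map_iff (by fun_prop) measurableSet_Ici]
    have h1 : ∀ᵐ p ∂(convPow ρ n).prod ρ, 0 ≤ p.1 :=
      Measure.quasiMeasurePreserving_fst.ae ih
    have h2 : ∀ᵐ p ∂(convPow ρ n).prod ρ, 0 ≤ p.2 :=
      Measure.quasiMeasurePreserving_snd.ae hρ
    filter_upwards [h1, h2] with p hp1 hp2 using add_nonneg hp1 hp2

lemma norm_exp_mul_le_one {z : ℂ} (hz : z.re ≤ 0) {y : ℝ} (hy : 0 ≤ y) :
    ‖Complex.exp (z * y)‖ ≤ 1 := by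
  rw [Complex.norm_exp, Real.exp_le_one_iff]
  simpa using mul_nonpos_of_nonpos_of_nonneg hz hy

lemma integrable_exp_mul {ρ : Measure ℝ} [IsFiniteMeasure ρ] (hρ : ∀ᵐ y ∂ρ, 0 ≤ y)
    {z : ℂ} (hz : z.re ≤ 0) : Integrable (fun y : ℝ => Complex.exp (z * y)) ρ := by
  refine (integrable_const (1 : ℝ)).mono' (by fun_prop) ?_
  filter_upwards [hρ] with y hy using norm_exp_mul_le_one hz hy

lemma integral_exp_convPow {ρ : Measure ℝ} [IsProbabilityMeasure ρ] (hρ : ∀ᵐ y ∂ρ, 0 ≤ y)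
    {z : ℂ} (hz : z.re ≤ 0) (n : ℕ) :
    ∫ y : ℝ, Complex.exp (z * y) ∂convPow ρ n = (∫ y : ℝ, Complex.exp (z * y) ∂ρ) ^ n := by
  induction n with
  | zero => simp [convPow]
  | succ n ih =>
    have h := integrable_exp_mul (ae_nonneg_convPow hρ (n + 1)) hz
    simp only [convPow] at h ⊢
    rw [integral_conv h, pow_succ, ← ih]
    simp [mul_add, Complex.exp_add, integral_const_mul, integral_mul_const]

/-- The mean value inequality on the half-plane `Re w ≤ 0`, where `|exp' w| ≤ 1`. -/
lemma norm_exp_sub_one_le_of_re_nonpos {w : ℂ} (hw : w.re ≤ 0) :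
    ‖Complex.exp w - 1‖ ≤ ‖w‖ := by
  have hconv : Convex ℝ {w : ℂ | w.re ≤ 0} := convex_halfSpace_re_le 0
  have := hconv.norm_image_sub_le_of_norm_hasDerivWithin_le (f := Complex.exp) (f' := Complex.exp)
    (C := 1) (x := 0) (y := w) (fun x _ => (Complex.hasDerivAt_exp x).hasDerivWithinAt)
    (fun x hx => by rw [Complex.norm_exp]; simpa using hx) (by simp) hw
  simpa using this

section Poisson

variable {E : Type*} [MeasurableSpace E] {m : Measure E} {h : E → ℝ}

lemma norm_exp_mul_sub_one_le {z : ℂ} (hz : z.re ≤ 0) {y : ℝ} (hy : 0 ≤ y) :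
    ‖Complex.exp (z * y) - 1‖ ≤ ‖z‖ * y := by
  refine (norm_exp_sub_one_le_of_re_nonpos ?_).trans (by simp [abs_of_nonneg hy])
  simpa using mul_nonpos_of_nonpos_of_nonneg hz hy

lemma integrable_exp_mul_sub_one (hm : Measurable h) (h0 : ∀ x, 0 ≤ h x) (hi : Integrable h m)
    {z : ℂ} (hz : z.re ≤ 0) : Integrable (fun x => Complex.exp (z * h x) - 1) m :=
  (hi.const_mul ‖z‖).mono' (by fun_prop)
    (ae_of_all _ fun x => norm_exp_mul_sub_one_le hz (h0 x))

/-- An approximation to the law of the Poisson integral `∫_A h dN` by a law on `[0, ∞)`, namely the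
`n`-fold convolution of `(1 - m(A)/n) δ₀ + (1/n) h_*(m|_A)`. -/
lemma exists_binomial_law (hm : Measurable h) (h0 : ∀ x, 0 ≤ h x) {A : Set E} (n : ℕ)
    (hn : 0 < n) (hmA : m A ≤ n) :
    ∃ ρ : ProbabilityMeasure ℝ, (∀ᵐ y ∂(ρ : Measure ℝ), 0 ≤ y) ∧ ∀ z : ℂ, z.re ≤ 0 →
      ∫ y : ℝ, Complex.exp (z * y) ∂(ρ : Measure ℝ) =
        (1 + (n : ℂ)⁻¹ * ∫ x in A, (Complex.exp (z * h x) - 1) ∂m) ^ n := by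
  have hn' : (0 : ℝ) < n := by exact_mod_cast hn
  have hfin : m A ≠ ⊤ := ne_top_of_le_ne_top (by simp) hmA
  have hreal : m.real A ≤ n := by
    simpa [Measure.real] using ENNReal.toReal_mono (by simp) hmA
  have : IsFiniteMeasure (m.restrict A) := ⟨by simpa using hfin.lt_top⟩
  set Λ : Measure ℝ := (m.restrict A).map h with hΛ
  have hΛ0 : ∀ᵐ y ∂Λ, 0 ≤ y := by
    rw [hΛ, ae_map_iff hm.aemeasurable measurableSet_Ici]
    exact ae_of_all _ h0
  set p : ℝ := m.real A / n with hp
  have hp0 : 0 ≤ p := by positivity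
  have hp1 : p ≤ 1 := by rw [hp, div_le_one hn']; exact hreal
  set β : Measure ℝ := ENNReal.ofReal (1 - p) • Measure.dirac 0 + ENNReal.ofReal ((n : ℝ)⁻¹) • Λ
    with hβ
  have hβ1 : IsProbabilityMeasure β := by
    refine ⟨?_⟩
    have hΛu : Λ univ = ENNReal.ofReal (m.real A) := by
      rw [hΛ, Measure.map_apply hm MeasurableSet.univ]
      simp [Measure.real, ENNReal.ofReal_toReal hfin]
    rw [hβ, Measure.add_apply, Measure.smul_apply, Measure.smul_apply, hΛu]
    simp only [measure_univ, smul_eq_mul, mul_one]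
    rw [← ENNReal.ofReal_mul (by positivity), ← ENNReal.ofReal_add (by linarith) (by positivity),
      ← ENNReal.ofReal_one]
    congr 1
    rw [hp]; ring
  have hβ0 : ∀ᵐ y ∂β, 0 ≤ y := by
    rw [hβ, ae_add_measure_iff]
    refine ⟨Measure.ae_smul_measure ?_ _, Measure.ae_smul_measure hΛ0 _⟩
    rw [ae_dirac_iff measurableSet_Ici]
  refine ⟨⟨convPow β n, inferInstance⟩, ae_nonneg_convPow hβ0 n, fun z hz => ?_⟩
  change ∫ y : ℝ, Complex.exp (z * y) ∂(convPow β n) = _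
  rw [integral_exp_convPow hβ0 hz]
  congr 1
  have hint : Integrable (fun x => Complex.exp (z * h x)) (m.restrict A) := by
    refine (integrable_const (1 : ℝ)).mono' (by fun_prop) ?_
    exact ae_of_all _ fun x => norm_exp_mul_le_one hz (h0 x)
  have hintΛ : Integrable (fun y : ℝ => Complex.exp (z * y)) Λ := integrable_exp_mul hΛ0 hz
  have hd : Integrable (fun y : ℝ => Complex.exp (z * y)) (Measure.dirac 0) :=
    integrable_exp_mul (by rw [ae_dirac_iff measurableSet_Ici]) hz
  rw [hβ, integral_add_measure (hd.smul_measure (by simp)) (hintΛ.smul_measure (by simp)),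
    integral_smul_measure, integral_smul_measure, hΛ, integral_map hm.aemeasurable (by fun_prop),
    integral_sub hint (integrable_const _)]
  have h1p : (0 : ℝ) ≤ 1 - p := by linarith
  rw [ENNReal.toReal_ofReal h1p, ENNReal.toReal_ofReal (inv_nonneg.2 hn'.le), hp]
  simp
  ring

/-- A probability measure on `ℝ` whose characteristic function is that of `∫ h dN`, `N` a Poisson
random measure with intensity `m` and `h ≥ 0` integrable, is carried by the half-line `[0, ∞)`, and
its Laplace transform is given by the same formula. It is the weak limit of binomial laws. -/
theorem ae_nonneg_and_laplace_of_charFun (hm : Measurable h) (h0 : ∀ x, 0 ≤ h x)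
    (hi : Integrable h m) {ρ : Measure ℝ} [IsProbabilityMeasure ρ]
    (hρ : ∀ θ : ℝ, charFun ρ θ =
      Complex.exp (∫ x, (Complex.exp ((θ * Complex.I) * h x) - 1) ∂m)) :
    (∀ᵐ y ∂ρ, 0 ≤ y) ∧
      ∫ y, Real.exp (-y) ∂ρ = Real.exp (∫ x, (Real.exp (-h x) - 1) ∂m) := by
  -- By Markov's inequality `{h > K / (n + 1)}` has measure at most `n + 1`.
  set K : ℝ := ∫ x, h x ∂m + 1 with hK
  have hKpos : 0 < K := by have := integral_nonneg (μ := m) (f := h) h0; positivity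
  set A : ℕ → Set E := fun n => {x | K / (n + 1 : ℝ) < h x} with hA
  have hAm : ∀ n, MeasurableSet (A n) := fun n => measurableSet_lt measurable_const hm
  have hAn : ∀ n, m (A n) ≤ (n + 1 : ℕ) := by
    intro n
    have hε : 0 < K / (n + 1 : ℝ) := by positivity
    have hfin : m {x | K / (n + 1 : ℝ) ≤ h x} ≠ ⊤ := (hi.measure_ge_lt_top hε).ne
    have h1 := mul_meas_ge_le_integral_of_nonneg (ae_of_all m h0) hi (K / (n + 1 : ℝ))
    have h2 : m.real {x | K / (n + 1 : ℝ) ≤ h x} ≤ (n + 1 : ℕ) := by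
      have h3 : K / (n + 1 : ℝ) * m.real {x | K / (n + 1 : ℝ) ≤ h x} ≤
          K / (n + 1 : ℝ) * (n + 1 : ℕ) := by
        refine h1.trans ?_
        have : K / (n + 1 : ℝ) * (n + 1 : ℕ) = K := by push_cast; field_simp
        rw [this]; linarith
      exact le_of_mul_le_mul_left h3 hε
    have hsub : A n ⊆ {x | K / (n + 1 : ℝ) ≤ h x} := fun x hx =>
      le_of_lt (show K / (n + 1 : ℝ) < h x from hx)
    refine (measure_mono hsub).trans ?_
    rw [← ENNReal.ofReal_toReal hfin]
    refine (ENNReal.ofReal_le_ofReal h2).trans ?_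
    rw [ENNReal.ofReal_natCast]
  choose π hπ0 hπ using fun n : ℕ =>
    exists_binomial_law hm h0 (n + 1) n.succ_pos (hAn n)
  have hlim : ∀ z : ℂ, z.re ≤ 0 → Tendsto (fun n => ∫ y : ℝ, Complex.exp (z * y) ∂(π n : Measure ℝ))
      atTop (𝓝 (Complex.exp (∫ x, (Complex.exp (z * h x) - 1) ∂m))) := by
    intro z hz
    have hI : Tendsto (fun n : ℕ => ∫ x in A n, (Complex.exp (z * h x) - 1) ∂m) atTop
        (𝓝 (∫ x, (Complex.exp (z * h x) - 1) ∂m)) := by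
      simp_rw [← integral_indicator (hAm _)]
      refine tendsto_integral_of_dominated_convergence (fun x => ‖z‖ * h x)
        (fun n => (Measurable.indicator (by fun_prop) (hAm n)).aestronglyMeasurable)
        (hi.const_mul _) (fun n => ae_of_all _ fun x => ?_) (ae_of_all _ fun x => ?_)
      · exact (norm_indicator_le_norm_self _ _).trans (norm_exp_mul_sub_one_le hz (h0 x))
      · rcases (h0 x).eq_or_lt with hx | hx
        · have : ∀ n, (A n).indicator (fun x => Complex.exp (z * h x) - 1) x = 0 := fun n => by
            rw [indicator_apply_eq_zero]; intro _; simp [← hx]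
          simp [this, ← hx]
        · refine tendsto_const_nhds.congr' ?_
          have ht : Tendsto (fun n : ℕ => K / (n + 1 : ℝ)) atTop (𝓝 0) := by
            have := (tendsto_one_div_add_atTop_nhds_zero_nat (𝕜 := ℝ)).const_mul K
            simpa [div_eq_mul_inv] using this
          filter_upwards [ht.eventually_lt_const hx] with n hn
          rw [indicator_of_mem (show x ∈ A n from hn)]
    -- `A n` goes with the exponent `n + 1`, hence the shift
    have hg : Tendsto (fun n : ℕ => (1 + ((n : ℂ)⁻¹ *
        ∫ x in A (n - 1), (Complex.exp (z * h x) - 1) ∂m)) ^ n) atTop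
        (𝓝 (Complex.exp (∫ x, (Complex.exp (z * h x) - 1) ∂m))) := by
      refine Complex.tendsto_one_add_pow_exp_of_tendsto ?_
      refine (hI.comp (tendsto_sub_atTop_nat 1)).congr' ?_
      filter_upwards [eventually_gt_atTop 0] with n hn
      have : (n : ℂ) ≠ 0 := by exact_mod_cast hn.ne'
      simp [mul_inv_cancel_left₀ this]
    refine (hg.comp (tendsto_add_atTop_nat 1)).congr fun n => ?_
    simp [hπ n z hz]
  set ρ' : ProbabilityMeasure ℝ := ⟨ρ, inferInstance⟩ with hρ'
  have hweak : Tendsto π atTop (𝓝 ρ') := by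
    refine ProbabilityMeasure.tendsto_of_tendsto_charFun fun θ => ?_
    have hz : ((θ : ℂ) * Complex.I).re ≤ 0 := by simp
    have := hlim _ hz
    rw [← hρ θ] at this
    refine this.congr fun n => ?_
    rw [charFun_apply_real]
    simp_rw [mul_right_comm]
  rw [ProbabilityMeasure.tendsto_iff_forall_integral_tendsto] at hweak
  -- the bounded function `min y⁻ 1` has integral zero along the sequence, hence in the limit
  have hnonneg : ∀ᵐ y ∂ρ, 0 ≤ y := by
    let g : BoundedContinuousFunction ℝ ℝ :=
      BoundedContinuousFunction.ofNormedAddCommGroup (fun y : ℝ => min (max (-y) 0) 1)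
        (by fun_prop) 1 (fun y => by
          rw [Real.norm_of_nonneg (le_min (le_max_right _ _) zero_le_one)]
          exact min_le_right _ _)
    have hg0 : ∀ y, 0 ≤ g y := fun y => le_min (le_max_right _ _) zero_le_one
    have h1 := hweak g
    have h2 : ∀ n, ∫ y, g y ∂(π n : Measure ℝ) = 0 := fun n => by
      refine integral_eq_zero_of_ae ?_
      filter_upwards [hπ0 n] with y hy
      change min (max (-y) 0) 1 = 0
      rw [max_eq_right (by linarith), min_eq_left zero_le_one]
    simp only [h2] at h1
    have h3 : ∫ y, g y ∂ρ = 0 := tendsto_nhds_unique h1 tendsto_const_nhds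
    rw [integral_eq_zero_iff_of_nonneg hg0 (g.integrable ρ)] at h3
    filter_upwards [h3] with y hy
    by_contra hlt
    push Not at hlt
    have : 0 < g y := lt_min (lt_max_of_lt_left (by linarith)) one_pos
    exact this.ne' hy
  refine ⟨hnonneg, ?_⟩
  let g : BoundedContinuousFunction ℝ ℝ :=
    BoundedContinuousFunction.ofNormedAddCommGroup (fun y : ℝ => Real.exp (-(max y 0)))
      (by fun_prop) 1 (fun y => by
        rw [Real.norm_of_nonneg (Real.exp_pos _).le, Real.exp_le_one_iff]
        simp)
  have hg : ∀ {y : ℝ}, 0 ≤ y → g y = Real.exp (-y) := fun {y} hy => by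
    change Real.exp (-(max y 0)) = _
    rw [max_eq_left hy]
  have h1 := hweak g
  have h2 : ∫ y, g y ∂ρ = ∫ y, Real.exp (-y) ∂ρ := by
    refine integral_congr_ae ?_
    filter_upwards [hnonneg] with y hy using hg hy
  have h3 := hlim (-1) (by simp)
  have h4 : ∀ n, ∫ y : ℝ, Complex.exp (-1 * y) ∂(π n : Measure ℝ) =
      ((∫ y, g y ∂(π n : Measure ℝ) : ℝ) : ℂ) := fun n => by
    rw [← integral_complex_ofReal]
    refine integral_congr_ae ?_
    filter_upwards [hπ0 n] with y hy
    rw [hg hy]; push_cast; ring_nf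
  have h5 : Complex.exp (∫ x, (Complex.exp (-1 * h x) - 1) ∂m) =
      ((Real.exp (∫ x, (Real.exp (-h x) - 1) ∂m) : ℝ) : ℂ) := by
    rw [Complex.ofReal_exp, ← integral_complex_ofReal]
    push_cast
    simp
  simp only [h4] at h3
  rw [h5] at h3
  rw [← h2]
  have h1' := (Complex.continuous_ofReal.tendsto _).comp h1
  exact_mod_cast tendsto_nhds_unique h1' h3

end Poisson

/-! ### The characteristic exponent of the centered noise -/

/-- The compensated exponential `e^{ia} - 1 - ia`. -/
noncomputable def compExp (a : ℝ) : ℂ :=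
  Complex.exp (Complex.I * (a : ℂ)) - 1 - Complex.I * (a : ℂ)

@[fun_prop]
lemma continuous_compExp : Continuous compExp := by unfold compExp; fun_prop

lemma compExp_zero : compExp 0 = 0 := by simp [compExp]

lemma re_compExp_nonpos (a : ℝ) : (compExp a).re ≤ 0 := by
  have h : (compExp a).re = Real.cos a - 1 := by
    simp [compExp, mul_comm Complex.I, Complex.exp_ofReal_mul_I_re]
  rw [h]; linarith [Real.cos_le_one a]

lemma norm_compExp_sub_le (a b : ℝ) :
    ‖compExp a - compExp b‖ ≤ (|a| + |b|) * |a - b| := by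
  have hder : ∀ x : ℝ, HasDerivAt compExp (Complex.I * (Complex.exp (Complex.I * x) - 1)) x := by
    intro x
    have h1 : HasDerivAt (fun y : ℝ => Complex.I * (y : ℂ)) Complex.I x := by
      simpa using (Complex.ofRealCLM.hasDerivAt (x := x)).const_mul Complex.I
    have h2 := (h1.cexp.sub_const 1).sub h1
    rw [show Complex.I * (Complex.exp (Complex.I * x) - 1) =
      Complex.exp (Complex.I * x) * Complex.I - Complex.I by ring]
    exact h2
  have hconv : Convex ℝ (Icc (-(|a| + |b|)) (|a| + |b|)) := convex_Icc _ _
  have := hconv.norm_image_sub_le_of_norm_hasDerivWithin_le (f := compExp)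
    (C := |a| + |b|) (x := b) (y := a) (fun x _ => (hder x).hasDerivWithinAt)
    (fun x hx => by
      rw [norm_mul, Complex.norm_I, one_mul]
      exact Real.norm_exp_I_mul_ofReal_sub_one_le.trans
        (by rw [Real.norm_eq_abs]; exact abs_le.2 hx))
    ⟨by linarith [neg_abs_le b, abs_nonneg a], by linarith [le_abs_self b, abs_nonneg a]⟩
    ⟨by linarith [neg_abs_le a, abs_nonneg b], by linarith [le_abs_self a, abs_nonneg b]⟩
  simpa using this

lemma norm_compExp_le (a : ℝ) : ‖compExp a‖ ≤ a ^ 2 := by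
  have := norm_compExp_sub_le a 0
  simpa [compExp_zero, ← sq] using this

/-- Young's inequality turns `norm_compExp_sub_le` into a bound by squares, which integrates to an
`L²`-bound without Hölder's inequality. -/
lemma norm_compExp_sub_le_of_pos (a b : ℝ) {ε : ℝ} (hε : 0 < ε) :
    ‖compExp a - compExp b‖ ≤ (1 + ε⁻¹) * (a - b) ^ 2 + ε * b ^ 2 := by
  refine (norm_compExp_sub_le a b).trans ?_
  have h1 : |a| ≤ |a - b| + |b| := by simpa using abs_add_le (a - b) b
  have h2 : 2 * |b| * |a - b| ≤ ε⁻¹ * |a - b| ^ 2 + ε * |b| ^ 2 := by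
    have h3 : ε⁻¹ * |a - b| ^ 2 + ε * |b| ^ 2 - 2 * |b| * |a - b| =
        ε⁻¹ * (|a - b| - ε * |b|) ^ 2 := by field_simp; ring
    have : 0 ≤ ε⁻¹ * (|a - b| - ε * |b|) ^ 2 := by positivity
    linarith
  rw [← sq_abs (a - b), ← sq_abs b]
  nlinarith [abs_nonneg (a - b), mul_le_mul_of_nonneg_right h1 (abs_nonneg (a - b))]

/-- A Lévy measure with finite first moment is σ-finite, being finite on each `[1/(n+1), ∞)`. -/
lemma sFinite_of_integrable {σ : Measure (Ioi (0 : ℝ))}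
    (hσ : Integrable (fun τ : Ioi (0 : ℝ) => (τ : ℝ)) σ) : SFinite σ := by
  have : SigmaFinite σ := by
    refine ⟨⟨⟨fun n => {τ | 1 / (n + 1 : ℝ) ≤ (τ : ℝ)}, fun _ => trivial, fun n => ?_, ?_⟩⟩⟩
    · exact hσ.measure_ge_lt_top (by positivity)
    · refine eq_univ_of_forall fun τ => mem_iUnion.2 ?_
      obtain ⟨n, hn⟩ := exists_nat_one_div_lt (show (0 : ℝ) < τ from τ.2)
      exact ⟨n, hn.le⟩
  infer_instance

section Exponent

variable {σ : Measure (Ioi (0 : ℝ))}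

/-- The characteristic exponent `∫∫ (e^{iτf(z)} - 1 - iτf(z)) σ(dτ) dz` of the centered noise. -/
noncomputable def charExponent (σ : Measure (Ioi (0 : ℝ))) (f : ℝ × ℝ → ℝ) : ℂ :=
  ∫ p : (ℝ × ℝ) × Ioi (0 : ℝ), compExp (p.2 * f p.1) ∂(volume.prod σ)

lemma aestronglyMeasurable_mul_prod {f : ℝ × ℝ → ℝ} (hf : AEStronglyMeasurable f volume) :
    AEStronglyMeasurable (fun p : (ℝ × ℝ) × Ioi (0 : ℝ) => (p.2 : ℝ) * f p.1)
      (volume.prod σ) :=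
  AEStronglyMeasurable.mul (by fun_prop) hf.comp_fst

lemma integrable_sq_mul_prod (hσ2 : Integrable (fun τ : Ioi (0 : ℝ) => (τ : ℝ) ^ 2) σ)
    {f : ℝ × ℝ → ℝ} (hf : MemLp f 2 volume) :
    Integrable (fun p : (ℝ × ℝ) × Ioi (0 : ℝ) => ((p.2 : ℝ) * f p.1) ^ 2) (volume.prod σ) := by
  refine (hf.integrable_sq.mul_prod hσ2).congr (ae_of_all _ fun p => ?_)
  simp only; ring

lemma integrable_compExp (hσ2 : Integrable (fun τ : Ioi (0 : ℝ) => (τ : ℝ) ^ 2) σ)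
    {f : ℝ × ℝ → ℝ} (hf : MemLp f 2 volume) :
    Integrable (fun p : (ℝ × ℝ) × Ioi (0 : ℝ) => compExp (p.2 * f p.1)) (volume.prod σ) := by
  refine (integrable_sq_mul_prod hσ2 hf).mono' ?_ (ae_of_all _ fun p => norm_compExp_le _)
  exact continuous_compExp.comp_aestronglyMeasurable (aestronglyMeasurable_mul_prod hf.1)

lemma re_charExponent_nonpos (hσ2 : Integrable (fun τ : Ioi (0 : ℝ) => (τ : ℝ) ^ 2) σ)
    {f : ℝ × ℝ → ℝ} (hf : MemLp f 2 volume) : (charExponent σ f).re ≤ 0 := by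
  have := integral_re (integrable_compExp hσ2 hf)
  simp only [RCLike.re_eq_complex_re] at this
  rw [charExponent, ← this]
  exact integral_nonpos fun p => re_compExp_nonpos _

variable [SFinite σ]

lemma integral_sq_mul_prod (f : ℝ × ℝ → ℝ) :
    ∫ p : (ℝ × ℝ) × Ioi (0 : ℝ), ((p.2 : ℝ) * f p.1) ^ 2 ∂(volume.prod σ) =
      (∫ τ, (τ : ℝ) ^ 2 ∂σ) * ∫ z, f z ^ 2 := by
  rw [mul_comm, ← integral_prod_mul]
  refine integral_congr_ae (ae_of_all _ fun p => ?_)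
  simp only; ring

lemma norm_charExponent_le (hσ2 : Integrable (fun τ : Ioi (0 : ℝ) => (τ : ℝ) ^ 2) σ)
    {f : ℝ × ℝ → ℝ} (hf : MemLp f 2 volume) :
    ‖charExponent σ f‖ ≤ (∫ τ, (τ : ℝ) ^ 2 ∂σ) * ∫ z, f z ^ 2 := by
  rw [← integral_sq_mul_prod]
  exact norm_integral_le_of_norm_le (integrable_sq_mul_prod hσ2 hf)
    (ae_of_all _ fun p => norm_compExp_le _)

lemma norm_charExponent_sub_le (hσ2 : Integrable (fun τ : Ioi (0 : ℝ) => (τ : ℝ) ^ 2) σ)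
    {f g : ℝ × ℝ → ℝ} (hf : MemLp f 2 volume) (hg : MemLp g 2 volume) {ε : ℝ} (hε : 0 < ε) :
    ‖charExponent σ f - charExponent σ g‖ ≤ (∫ τ, (τ : ℝ) ^ 2 ∂σ) *
      ((1 + ε⁻¹) * (∫ z, (f z - g z) ^ 2) + ε * ∫ z, g z ^ 2) := by
  rw [charExponent, charExponent,
    ← integral_sub (integrable_compExp hσ2 hf) (integrable_compExp hσ2 hg)]
  have hfg := integrable_sq_mul_prod hσ2 (hf.sub hg)
  have hgg := integrable_sq_mul_prod hσ2 hg
  have h := norm_integral_le_of_norm_le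
    (f := fun p : (ℝ × ℝ) × Ioi (0 : ℝ) => compExp (p.2 * f p.1) - compExp (p.2 * g p.1))
    ((hfg.const_mul (1 + ε⁻¹)).add (hgg.const_mul ε))
    (ae_of_all _ fun p => by
      have := norm_compExp_sub_le_of_pos (p.2 * f p.1) (p.2 * g p.1) hε
      simpa [mul_sub] using this)
  refine h.trans (le_of_eq ?_)
  simp only [Pi.add_apply]
  rw [integral_add (hfg.const_mul _) (hgg.const_mul _), integral_const_mul, integral_const_mul,
    integral_sq_mul_prod, integral_sq_mul_prod]
  simp only [Pi.sub_apply]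
  ring

lemma integral_sq_eq_norm_sq {α : Type*} [MeasurableSpace α] {m : Measure α} (f : Lp ℝ 2 m) :
    ∫ x, f x ^ 2 ∂m = ‖f‖ ^ 2 := by
  rw [← real_inner_self_eq_norm_sq, L2.inner_def]
  simp [sq]

lemma continuous_charExponent (hσ2 : Integrable (fun τ : Ioi (0 : ℝ) => (τ : ℝ) ^ 2) σ) :
    Continuous (fun f : Lp ℝ 2 (volume : Measure (ℝ × ℝ)) => charExponent σ f) := by
  rw [continuous_iff_continuousAt]
  intro g
  set V := ∫ τ, (τ : ℝ) ^ 2 ∂σ with hV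
  have hV0 : 0 ≤ V := integral_nonneg fun τ => sq_nonneg _
  have hle : ∀ (f : Lp ℝ 2 (volume : Measure (ℝ × ℝ))) {ε : ℝ}, 0 < ε →
      ‖charExponent σ f - charExponent σ g‖ ≤ V * ((1 + ε⁻¹) * ‖f - g‖ ^ 2 + ε * ‖g‖ ^ 2) := by
    intro f ε hε
    have h := norm_charExponent_sub_le hσ2 (Lp.memLp f) (Lp.memLp g) hε
    have h1 : ∫ z, (f z - g z) ^ 2 = ‖f - g‖ ^ 2 := by
      rw [← integral_sq_eq_norm_sq]
      refine integral_congr_ae ?_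
      filter_upwards [Lp.coeFn_sub f g] with z hz
      rw [hz, Pi.sub_apply]
    rwa [h1, integral_sq_eq_norm_sq] at h
  rw [ContinuousAt, tendsto_iff_norm_sub_tendsto_zero, Metric.tendsto_nhds]
  intro δ hδ
  set ε := δ / (2 * (V * ‖g‖ ^ 2 + 1)) with hε
  have hε0 : 0 < ε := by positivity
  have ht : Tendsto (fun f : Lp ℝ 2 (volume : Measure (ℝ × ℝ)) => V * ((1 + ε⁻¹) * ‖f - g‖ ^ 2))
      (𝓝 g) (𝓝 0) := by
    have : Continuous (fun f : Lp ℝ 2 (volume : Measure (ℝ × ℝ)) =>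
      V * ((1 + ε⁻¹) * ‖f - g‖ ^ 2)) := by fun_prop
    simpa using this.tendsto g
  filter_upwards [ht.eventually_lt_const (half_pos hδ)] with f hf
  rw [dist_zero_right, norm_norm]
  refine (hle f hε0).trans_lt ?_
  have h2 : V * (ε * ‖g‖ ^ 2) ≤ δ / 2 := by
    have : V * (ε * ‖g‖ ^ 2) = δ / 2 * ((V * ‖g‖ ^ 2) / (V * ‖g‖ ^ 2 + 1)) := by
      rw [hε]; field_simp
    rw [this]
    refine mul_le_of_le_one_right (by positivity) ?_
    rw [div_le_one (by positivity)]; linarith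
  rw [mul_add]; linarith

end Exponent

/-! ### Second moments of the noise and the extension to `L²` -/

section Noise

lemma measurable_eval (φ : Test) : Measurable (fun ω : Dist => ω φ) :=
  (comap_measurable (fun ω : Dist => ω φ)).mono 
    (le_iSup (fun φ : Test => MeasurableSpace.comap (fun ω : Dist => ω φ) inferInstance) φ) le_rfl

lemma memLp_test (φ : Test) : MemLp (φ : ℝ × ℝ → ℝ) 2 volume :=
  φ.continuous.memLp_of_hasCompactSupport φ.hasCompactSupport

variable {σ : Measure (Ioi (0 : ℝ))} [SFinite σ] {ν : Measure Dist}

lemma integral_exp_eval (hσ2 : Integrable (fun τ : Ioi (0 : ℝ) => (τ : ℝ) ^ 2) σ)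
    (hν : IsCenteredLevyNoise σ ν) (φ : Test) :
    ∫ ω : Dist, Complex.exp (Complex.I * ((ω φ : ℝ) : ℂ)) ∂ν =
      Complex.exp (charExponent σ φ) := by
  rw [hν φ, charExponent, integral_prod _ (integrable_compExp hσ2 (memLp_test φ))]
  simp [compExp, mul_assoc]

variable [IsProbabilityMeasure ν]

lemma integral_one_sub_cos_le (hσ2 : Integrable (fun τ : Ioi (0 : ℝ) => (τ : ℝ) ^ 2) σ)
    (hν : IsCenteredLevyNoise σ ν) (φ : Test) :
    ∫ ω : Dist, (1 - Real.cos (ω φ)) ∂ν ≤ (∫ τ, (τ : ℝ) ^ 2 ∂σ) * ∫ z, φ z ^ 2 := by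
  have hint : Integrable (fun ω : Dist => Complex.exp (Complex.I * ((ω φ : ℝ) : ℂ))) ν := by
    refine (integrable_const (1 : ℝ)).mono' ?_ (ae_of_all _ fun ω => ?_)
    · exact (Complex.measurable_exp.comp ((Complex.measurable_ofReal.comp
        (measurable_eval φ)).const_mul Complex.I)).aestronglyMeasurable
    · rw [mul_comm, Complex.norm_exp_ofReal_mul_I]
  have h1 : ∫ ω : Dist, (1 - Real.cos (ω φ)) ∂ν = (1 - Complex.exp (charExponent σ φ)).re := by
    rw [← integral_exp_eval hσ2 hν φ, Complex.sub_re]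
    have h2 := integral_re hint
    simp only [RCLike.re_eq_complex_re] at h2
    have h3 : ∀ ω : Dist, (Complex.exp (Complex.I * ((ω φ : ℝ) : ℂ))).re = Real.cos (ω φ) :=
      fun ω => by rw [mul_comm, Complex.exp_ofReal_mul_I_re]
    have h4 := hint.re
    simp only [RCLike.re_eq_complex_re, h3] at h4 h2
    rw [← h2, integral_sub (integrable_const _) h4]
    simp
  rw [h1]
  refine (Complex.re_le_norm _).trans ?_
  rw [norm_sub_rev]
  exact (norm_exp_sub_one_le_of_re_nonpos (re_charExponent_nonpos hσ2 (memLp_test φ))).trans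
    (norm_charExponent_le hσ2 (memLp_test φ))

/-- The second moment of `⟨·, φ⟩` is controlled by the `L²`-norm of `φ`. As the characteristic
function is not known to be twice differentiable beforehand, integrability is part of the claim,
which is therefore stated for the integral in `[0, ∞]`. -/
lemma lintegral_sq_eval_le (hσ2 : Integrable (fun τ : Ioi (0 : ℝ) => (τ : ℝ) ^ 2) σ)
    (hν : IsCenteredLevyNoise σ ν) (φ : Test) :
    ∫⁻ ω : Dist, ENNReal.ofReal ((ω φ) ^ 2) ∂ν ≤
      ENNReal.ofReal (Real.pi ^ 2 / 2 * ((∫ τ, (τ : ℝ) ^ 2 ∂σ) * ∫ z, φ z ^ 2)) := by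
  -- `x² ≤ (π² / 2) n² (1 - cos (x / n))` as soon as `|x| ≤ n π`; then Fatou's lemma applies.
  set F : ℕ → Dist → ℝ≥0∞ := fun n ω =>
    ENNReal.ofReal (Real.pi ^ 2 / 2 * (n : ℝ) ^ 2 * (1 - Real.cos (ω ((n : ℝ)⁻¹ • φ)))) with hF
  have hcm : ∀ n : ℕ, Measurable (fun ω : Dist => 1 - Real.cos (ω ((n : ℝ)⁻¹ • φ))) := fun n =>
    (Real.measurable_cos.comp (measurable_eval _)).const_sub 1
  have hFm : ∀ n, Measurable (F n) := fun n => ((hcm n).const_mul _).ennreal_ofReal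
  have hbound : ∀ n : ℕ, 0 < n → ∫⁻ ω, F n ω ∂ν ≤
      ENNReal.ofReal (Real.pi ^ 2 / 2 * ((∫ τ, (τ : ℝ) ^ 2 ∂σ) * ∫ z, φ z ^ 2)) := by
    intro n hn
    have hn' : (0 : ℝ) < n := by exact_mod_cast hn
    have hnn : ∀ ω : Dist, 0 ≤ 1 - Real.cos (ω ((n : ℝ)⁻¹ • φ)) := fun ω => by
      linarith [Real.cos_le_one (ω ((n : ℝ)⁻¹ • φ))]
    have hi : Integrable (fun ω : Dist => 1 - Real.cos (ω ((n : ℝ)⁻¹ • φ))) ν := by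
      refine (integrable_const (2 : ℝ)).mono' (hcm n).aestronglyMeasurable (ae_of_all _ fun ω => ?_)
      rw [Real.norm_of_nonneg (hnn ω)]
      linarith [Real.neg_one_le_cos (ω ((n : ℝ)⁻¹ • φ))]
    rw [hF, ← ofReal_integral_eq_lintegral_ofReal (hi.const_mul _)
      (ae_of_all _ fun ω => mul_nonneg (by positivity) (hnn ω)), integral_const_mul]
    refine ENNReal.ofReal_le_ofReal ?_
    have h1 := integral_one_sub_cos_le hσ2 hν ((n : ℝ)⁻¹ • φ)
    have h2 : ∫ z, ((n : ℝ)⁻¹ • φ : Test) z ^ 2 = ((n : ℝ) ^ 2)⁻¹ * ∫ z, φ z ^ 2 := by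
      rw [← integral_const_mul]
      refine integral_congr_ae (ae_of_all _ fun z => ?_)
      change ((n : ℝ)⁻¹ * φ z) ^ 2 = _
      rw [mul_pow, inv_pow]
    rw [h2] at h1
    calc _ ≤ Real.pi ^ 2 / 2 * (n : ℝ) ^ 2 *
          ((∫ τ, (τ : ℝ) ^ 2 ∂σ) * (((n : ℝ) ^ 2)⁻¹ * ∫ z, φ z ^ 2)) :=
          mul_le_mul_of_nonneg_left h1 (by positivity)
      _ = _ := by field_simp
  calc ∫⁻ ω : Dist, ENNReal.ofReal ((ω φ) ^ 2) ∂ν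
      ≤ ∫⁻ ω, liminf (fun n => F n ω) atTop ∂ν := by
        refine lintegral_mono fun ω => le_liminf_of_le (by isBoundedDefault) ?_
        obtain ⟨N, hN⟩ := exists_nat_gt (|ω φ| / Real.pi)
        filter_upwards [eventually_ge_atTop N, eventually_gt_atTop 0] with n hn hn0
        have hn' : (0 : ℝ) < n := by exact_mod_cast hn0
        refine ENNReal.ofReal_le_ofReal ?_
        rw [map_smul, smul_eq_mul]
        have hle : |(n : ℝ)⁻¹ * ω φ| ≤ Real.pi := by
          rw [abs_mul, abs_of_pos (inv_pos.2 hn'), inv_mul_le_iff₀ hn', ← div_le_iff₀ Real.pi_pos]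
          exact hN.le.trans (by exact_mod_cast hn)
        have hcos := Real.cos_le_one_sub_mul_cos_sq hle
        have h3 : 2 / Real.pi ^ 2 * ((n : ℝ)⁻¹ * ω φ) ^ 2 ≤ 1 - Real.cos ((n : ℝ)⁻¹ * ω φ) := by
          linarith
        calc (ω φ) ^ 2 = Real.pi ^ 2 / 2 * (n : ℝ) ^ 2 *
              (2 / Real.pi ^ 2 * ((n : ℝ)⁻¹ * ω φ) ^ 2) := by
              have := Real.pi_ne_zero
              field_simp
          _ ≤ _ := mul_le_mul_of_nonneg_left h3 (by positivity)
    _ ≤ liminf (fun n => ∫⁻ ω, F n ω ∂ν) atTop := lintegral_liminf_le hFm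
    _ ≤ _ := by
        refine (liminf_le_liminf (v := fun _ => _) ?_).trans (le_of_eq (liminf_const _))
        filter_upwards [eventually_gt_atTop 0] with n hn using hbound n hn

lemma memLp_eval (hσ2 : Integrable (fun τ : Ioi (0 : ℝ) => (τ : ℝ) ^ 2) σ)
    (hν : IsCenteredLevyNoise σ ν) (φ : Test) : MemLp (fun ω : Dist => ω φ) 2 ν := by
  have hm := (measurable_eval φ).aestronglyMeasurable (μ := ν)
  rw [memLp_two_iff_integrable_sq hm]
  refine ⟨hm.pow 2, ?_⟩
  rw [hasFiniteIntegral_iff_ofReal (ae_of_all _ fun ω => sq_nonneg _)]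
  exact (lintegral_sq_eval_le hσ2 hν φ).trans_lt ENNReal.ofReal_lt_top

/-- The embedding of the test functions into `L²(ℝ²)`. -/
noncomputable def testToLp : Test →ₗ[ℝ] Lp ℝ 2 (volume : Measure (ℝ × ℝ)) where
  toFun φ := (memLp_test φ).toLp φ
  map_add' φ ψ := MemLp.toLp_add (memLp_test φ) (memLp_test ψ)
  map_smul' c φ := MemLp.toLp_const_smul c (memLp_test φ)

lemma denseRange_testToLp : DenseRange testToLp := by
  refine (Lp.dense_hasCompactSupport_contDiff (F := ℝ) (μ := (volume : Measure (ℝ × ℝ)))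
    (p := 2) (by simp)).mono ?_
  rintro f ⟨g, hfg, hg, hg'⟩
  let φ : Test := ⟨g, hg', hg, by simp⟩
  exact ⟨φ, Lp.ext ((memLp_test φ).coeFn_toLp.trans hfg.symm)⟩

/-- The map `φ ↦ ⟨·, φ⟩` from test functions into `L²(ν)`. -/
noncomputable def evalToLp (h : ∀ φ : Test, MemLp (fun ω : Dist => ω φ) 2 ν) :
    Test →ₗ[ℝ] Lp ℝ 2 ν where
  toFun φ := (h φ).toLp _
  map_add' φ ψ := by
    rw [← MemLp.toLp_add]
    congr 1
    ext ω
    exact map_add ω φ ψ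
  map_smul' c φ := by
    rw [RingHom.id_apply, ← MemLp.toLp_const_smul]
    congr 1
    ext ω
    exact map_smul ω c φ

lemma integral_sq_toLp {α : Type*} [MeasurableSpace α] {m : Measure α} {f : α → ℝ}
    (hf : MemLp f 2 m) : ∫ x, f x ^ 2 ∂m = ‖hf.toLp f‖ ^ 2 := by
  rw [← integral_sq_eq_norm_sq]
  refine integral_congr_ae ?_
  filter_upwards [hf.coeFn_toLp] with x hx
  rw [hx]

lemma norm_evalToLp_le (hσ2 : Integrable (fun τ : Ioi (0 : ℝ) => (τ : ℝ) ^ 2) σ)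
    (hν : IsCenteredLevyNoise σ ν) (φ : Test) :
    ‖evalToLp (memLp_eval hσ2 hν) φ‖ ≤
      Real.sqrt (Real.pi ^ 2 / 2 * ∫ τ, (τ : ℝ) ^ 2 ∂σ) * ‖testToLp φ‖ := by
  have hV0 : 0 ≤ ∫ τ, (τ : ℝ) ^ 2 ∂σ := integral_nonneg fun τ => sq_nonneg _
  refine (sq_le_sq₀ (norm_nonneg _) (by positivity)).1 ?_
  rw [mul_pow, Real.sq_sqrt (by positivity)]
  have h1 := lintegral_sq_eval_le hσ2 hν φ
  rw [← ofReal_integral_eq_lintegral_ofReal (memLp_eval hσ2 hν φ).integrable_sq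
    (ae_of_all _ fun ω => sq_nonneg _), integral_sq_toLp (memLp_eval hσ2 hν φ),
    integral_sq_toLp (memLp_test φ), ENNReal.ofReal_le_ofReal_iff (by positivity)] at h1
  refine h1.trans (le_of_eq ?_)
  change _ = _ * ‖(memLp_test φ).toLp φ‖ ^ 2
  ring

end Noise

/-- `T` is the extension by continuity of `φ ↦ ⟨·, φ⟩` to a bounded operator
`L²(ℝ²) → L²(ν)`. -/
def IsPairingExtension (ν : Measure Dist)
    (T : Lp ℝ 2 (volume : Measure (ℝ × ℝ)) →L[ℝ] Lp ℝ 2 ν) : Prop :=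
  ∀ φ : Test, T (testToLp φ) =ᵐ[ν] fun ω : Dist => ω φ

section Extension

variable {σ : Measure (Ioi (0 : ℝ))} [SFinite σ] {ν : Measure Dist} [IsProbabilityMeasure ν]

theorem exists_isPairingExtension (hσ2 : Integrable (fun τ : Ioi (0 : ℝ) => (τ : ℝ) ^ 2) σ)
    (hν : IsCenteredLevyNoise σ ν) :
    (∃ T : Lp ℝ 2 (volume : Measure (ℝ × ℝ)) →L[ℝ] Lp ℝ 2 ν, IsPairingExtension ν T) := by
  refine ⟨(evalToLp (memLp_eval hσ2 hν)).extendOfNorm testToLp, fun φ => ?_⟩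
  rw [LinearMap.extendOfNorm_eq denseRange_testToLp ⟨_, norm_evalToLp_le hσ2 hν⟩]
  exact (memLp_eval hσ2 hν φ).coeFn_toLp

end Extension

section Pairing

variable {ν : Measure Dist} {T : Lp ℝ 2 (volume : Measure (ℝ × ℝ)) →L[ℝ] Lp ℝ 2 ν}

lemma tendsto_testToLp_iff {f : ℝ × ℝ → ℝ} (hf : MemLp f 2 volume) (φ : ℕ → Test) :
    Tendsto (fun n => testToLp (φ n)) atTop (𝓝 (hf.toLp f)) ↔
      Tendsto (fun n => eLpNorm (fun z => φ n z - f z) 2 volume) atTop (𝓝 0) :=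
  Lp.tendsto_Lp_iff_tendsto_eLpNorm'' (fun n => (φ n : ℝ × ℝ → ℝ)) (fun n => memLp_test (φ n)) f hf

lemma tendsto_eval_iff (hT : IsPairingExtension ν T) (Y : Lp ℝ 2 ν) (φ : ℕ → Test) :
    Tendsto (fun n => T (testToLp (φ n))) atTop (𝓝 Y) ↔
      Tendsto (fun n => eLpNorm (fun ω : Dist => ω (φ n) - Y ω) 2 ν) atTop (𝓝 0) := by
  rw [Lp.tendsto_Lp_iff_tendsto_eLpNorm']
  refine tendsto_congr fun n => eLpNorm_congr_ae ?_
  filter_upwards [hT (φ n)] with ω hω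
  rw [Pi.sub_apply, hω]

/-- The limit defining `⟨·, f⟩` exists and is unique. -/
lemma isPairing_iff (hT : IsPairingExtension ν T) {f : ℝ × ℝ → ℝ} (hf : MemLp f 2 volume)
    (Y : Lp ℝ 2 ν) : IsPairing ν f Y ↔ Y = T (hf.toLp f) := by
  constructor
  · rintro ⟨φ, h1, h2⟩
    rw [← tendsto_testToLp_iff hf] at h1
    rw [← tendsto_eval_iff hT] at h2
    exact tendsto_nhds_unique h2 ((T.continuous.tendsto _).comp h1)
  · rintro rfl
    obtain ⟨x, hx, hlim⟩ :=
      mem_closure_iff_seq_limit.1 (denseRange_testToLp.closure_range ▸ mem_univ (hf.toLp f))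
    choose φ hφ using hx
    have h1 : Tendsto (fun n => testToLp (φ n)) atTop (𝓝 (hf.toLp f)) := by simpa [hφ] using hlim
    exact ⟨φ, (tendsto_testToLp_iff hf φ).1 h1,
      (tendsto_eval_iff hT _ φ).1 ((T.continuous.tendsto _).comp h1)⟩

lemma pairing_eq (hT : IsPairingExtension ν T) {f : ℝ × ℝ → ℝ} (hf : MemLp f 2 volume) :
    pairing ν f = T (hf.toLp f) := by
  have h : ∃ Y : Lp ℝ 2 ν, IsPairing ν f Y := ⟨_, (isPairing_iff hT hf _).2 rfl⟩
  rw [pairing, dif_pos h]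
  exact (isPairing_iff hT hf _).1 h.choose_spec

end Pairing

lemma norm_exp_I_mul_sub_le (a b : ℝ) :
    ‖Complex.exp (Complex.I * (a : ℂ)) - Complex.exp (Complex.I * (b : ℂ))‖ ≤ |a - b| := by
  have h : Complex.exp (Complex.I * (a : ℂ)) - Complex.exp (Complex.I * (b : ℂ)) =
      Complex.exp (b * Complex.I) * (Complex.exp (Complex.I * ((a - b : ℝ) : ℂ)) - 1) := by
    rw [mul_sub, ← Complex.exp_add, mul_one, mul_comm _ Complex.I]
    congr 2
    push_cast; ring
  rw [h, norm_mul, Complex.norm_exp_ofReal_mul_I, one_mul]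
  exact Real.norm_exp_I_mul_ofReal_sub_one_le

lemma integrable_exp_I_mul {Ω : Type*} [MeasurableSpace Ω] {ν : Measure Ω} [IsFiniteMeasure ν]
    {Y : Ω → ℝ} (hY : AEStronglyMeasurable Y ν) :
    Integrable (fun ω => Complex.exp (Complex.I * (Y ω : ℂ))) ν := by
  refine (integrable_const (1 : ℝ)).mono' ?_ (ae_of_all _ fun ω => ?_)
  · have hc : Continuous fun y : ℝ => Complex.exp (Complex.I * (y : ℂ)) := by fun_prop
    exact hc.comp_aestronglyMeasurable hY
  · rw [mul_comm, Complex.norm_exp_ofReal_mul_I]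

lemma continuous_integral_exp_I_mul {Ω : Type*} [MeasurableSpace Ω] {ν : Measure Ω}
    [IsProbabilityMeasure ν] :
    Continuous (fun Y : Lp ℝ 2 ν => ∫ ω, Complex.exp (Complex.I * ((Y ω : ℝ) : ℂ)) ∂ν) := by
  refine LipschitzWith.continuous (K := 1) (LipschitzWith.of_dist_le_mul fun Y Z => ?_)
  rw [dist_eq_norm, dist_eq_norm, NNReal.coe_one, one_mul,
    ← integral_sub (integrable_exp_I_mul (Lp.aestronglyMeasurable Y))
      (integrable_exp_I_mul (Lp.aestronglyMeasurable Z))]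
  have hL : MemLp (Y - Z : Lp ℝ 2 ν) 1 ν := (Lp.memLp (Y - Z)).mono_exponent one_le_two
  have h1 : ∫ ω, |(Y - Z : Lp ℝ 2 ν) ω| ∂ν ≤ ‖Y - Z‖ := by
    have h2 := eLpNorm_le_eLpNorm_of_exponent_le (μ := ν) (p := 1) (q := 2) one_le_two
      (Lp.aestronglyMeasurable (Y - Z))
    have h3 := ENNReal.toReal_mono (Lp.eLpNorm_ne_top (Y - Z)) h2
    rw [eLpNorm_one_eq_lintegral_enorm,
      ← integral_norm_eq_lintegral_enorm (Lp.aestronglyMeasurable (Y - Z))] at h3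
    rw [Lp.norm_def]
    exact h3
  refine (norm_integral_le_of_norm_le (memLp_one_iff_integrable.1 hL).abs ?_).trans h1
  filter_upwards [Lp.coeFn_sub Y Z] with ω hω
  rw [hω]
  exact norm_exp_I_mul_sub_le _ _

section Positive

variable {σ : Measure (Ioi (0 : ℝ))} [SFinite σ] {ν : Measure Dist} [IsProbabilityMeasure ν]
  {T : Lp ℝ 2 (volume : Measure (ℝ × ℝ)) →L[ℝ] Lp ℝ 2 ν}

/-- The formula for the characteristic function extends from test functions to `L²(ℝ²)` by
density. -/
lemma integral_exp_pairing (hσ2 : Integrable (fun τ : Ioi (0 : ℝ) => (τ : ℝ) ^ 2) σ)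
    (hν : IsCenteredLevyNoise σ ν) (hT : IsPairingExtension ν T)
    (f : Lp ℝ 2 (volume : Measure (ℝ × ℝ))) :
    ∫ ω, Complex.exp (Complex.I * ((T f ω : ℝ) : ℂ)) ∂ν = Complex.exp (charExponent σ f) := by
  refine denseRange_testToLp.induction_on (p := fun f =>
    ∫ ω, Complex.exp (Complex.I * ((T f ω : ℝ) : ℂ)) ∂ν = Complex.exp (charExponent σ f)) f
    (isClosed_eq (continuous_integral_exp_I_mul.comp T.continuous)
      (Complex.continuous_exp.comp (continuous_charExponent hσ2))) fun φ => ?_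
  have h1 : ∫ ω, Complex.exp (Complex.I * ((T (testToLp φ) ω : ℝ) : ℂ)) ∂ν =
      ∫ ω : Dist, Complex.exp (Complex.I * ((ω φ : ℝ) : ℂ)) ∂ν := by
    refine integral_congr_ae ?_
    filter_upwards [hT φ] with ω hω
    rw [hω]
  have h2 : charExponent σ (testToLp φ) = charExponent σ φ := by
    refine integral_congr_ae ?_
    have := Measure.quasiMeasurePreserving_fst (μ := (volume : Measure (ℝ × ℝ))) (ν := σ) |>.ae
      (memLp_test φ).coeFn_toLp
    filter_upwards [this] with p hp
    change compExp (p.2 * (memLp_test φ).toLp φ p.1) = _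
    rw [hp]
  rw [h1, h2, integral_exp_eval hσ2 hν]

/-- For `f ≥ 0` the pairing with the uncompensated noise is nonnegative, and the Laplace transform
of the pairing with the centered noise is the analytic continuation of its characteristic
function. -/
theorem pairing_nonneg_and_laplace (hσ2 : Integrable (fun τ : Ioi (0 : ℝ) => (τ : ℝ) ^ 2) σ)
    (hσ1 : Integrable (fun τ : Ioi (0 : ℝ) => (τ : ℝ)) σ)
    (hν : IsCenteredLevyNoise σ ν) (hT : IsPairingExtension ν T)
    {f : Lp ℝ 2 (volume : Measure (ℝ × ℝ))} (hf0 : 0 ≤ f) (hfi : Integrable f volume) :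
    (∀ᵐ ω ∂ν, 0 ≤ T f ω + (∫ z, f z) * ∫ τ, (τ : ℝ) ∂σ) ∧
      ∫ ω, Real.exp (-T f ω) ∂ν = Real.exp (∫ p : (ℝ × ℝ) × Ioi (0 : ℝ),
        (Real.exp (-(p.2 * f p.1)) - 1 + p.2 * f p.1) ∂(volume.prod σ)) := by
  rw [← Lp.coeFn_nonneg] at hf0
  -- a nonnegative and measurable representative of `f`
  set h : (ℝ × ℝ) × Ioi (0 : ℝ) → ℝ := fun p => p.2 * max (f p.1) 0 with hh
  have hm : Measurable h := by
    have := (Lp.stronglyMeasurable f).measurable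
    simp only [hh]
    fun_prop
  have h0 : ∀ p, 0 ≤ h p := fun p =>
    mul_nonneg (le_of_lt (show (0 : ℝ) < p.2 from p.2.2)) (le_max_right _ _)
  have hae : ∀ᵐ p ∂((volume : Measure (ℝ × ℝ)).prod σ), h p = p.2 * f p.1 := by
    filter_upwards [Measure.quasiMeasurePreserving_fst.ae hf0] with p hp
    simp only [hh]
    rw [max_eq_left (show 0 ≤ f p.1 from hp)]
  have hfp : Integrable (fun p : (ℝ × ℝ) × Ioi (0 : ℝ) => (p.2 : ℝ) * f p.1)
      (volume.prod σ) := by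
    refine (hfi.mul_prod hσ1).congr (ae_of_all _ fun p => ?_)
    exact mul_comm _ _
  have hi : Integrable h (volume.prod σ) := hfp.congr (hae.mono fun p hp => hp.symm)
  set c : ℝ := (∫ z, f z) * ∫ τ, (τ : ℝ) ∂σ with hc
  have hch : ∫ p, h p ∂(volume.prod σ) = c := by
    rw [hc, ← integral_prod_mul]
    refine integral_congr_ae (hae.mono fun p hp => ?_)
    rw [hp]; exact mul_comm _ _
  have hYm : Measurable fun ω => T f ω + c :=
    ((Lp.stronglyMeasurable (T f)).measurable).add_const c
  set ρ : Measure ℝ := ν.map fun ω => T f ω + c with hρ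
  have : IsProbabilityMeasure ρ := Measure.isProbabilityMeasure_map hYm.aemeasurable
  have hchar : ∀ θ : ℝ, charFun ρ θ =
      Complex.exp (∫ p, (Complex.exp ((θ * Complex.I) * h p) - 1) ∂(volume.prod σ)) := by
    intro θ
    have hint : Integrable (fun p => Complex.exp ((θ * Complex.I) * h p) - 1) (volume.prod σ) :=
      integrable_exp_mul_sub_one hm h0 hi (by simp)
    have h1 : charExponent σ (θ • f : Lp ℝ 2 (volume : Measure (ℝ × ℝ))) =
        ∫ p, (Complex.exp ((θ * Complex.I) * h p) - 1) ∂(volume.prod σ) -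
          Complex.I * θ * c := by
      have hi' : Integrable (fun p => Complex.I * θ * (h p : ℂ)) (volume.prod σ) :=
        hi.ofReal.const_mul _
      rw [← hch, ← integral_complex_ofReal, ← integral_const_mul, ← integral_sub hint hi']
      refine integral_congr_ae ?_
      filter_upwards [hae, Measure.quasiMeasurePreserving_fst.ae (Lp.coeFn_smul θ f)] with p hp hp'
      rw [hp, hp', compExp, Pi.smul_apply, smul_eq_mul]
      push_cast
      ring_nf
    rw [charFun_apply_real, hρ, integral_map hYm.aemeasurable (by fun_prop)]
    have h2 : ∀ᵐ ω ∂ν, Complex.exp (θ * ((T f ω + c : ℝ) : ℂ) * Complex.I) =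
        Complex.exp (Complex.I * ((T (θ • f) ω : ℝ) : ℂ)) * Complex.exp (Complex.I * θ * c) := by
      rw [map_smul]
      filter_upwards [Lp.coeFn_smul θ (T f)] with ω hω
      rw [hω, Pi.smul_apply, smul_eq_mul, ← Complex.exp_add]
      congr 1
      push_cast
      ring
    rw [integral_congr_ae h2, integral_mul_const, integral_exp_pairing hσ2 hν hT, h1,
      ← Complex.exp_add]
    congr 1
    ring
  obtain ⟨hpos, hlap⟩ := ae_nonneg_and_laplace_of_charFun hm h0 hi hchar
  refine ⟨?_, ?_⟩
  · rwa [hρ, ae_map_iff hYm.aemeasurable measurableSet_Ici] at hpos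
  · rw [hρ, integral_map hYm.aemeasurable (by fun_prop)] at hlap
    simp only [neg_add, Real.exp_add] at hlap
    rw [integral_mul_const] at hlap
    have hint : Integrable (fun p => Real.exp (-h p) - 1) (volume.prod σ) := by
      refine hi.mono' (by fun_prop) (ae_of_all _ fun p => ?_)
      rw [Real.norm_eq_abs, abs_sub_comm, abs_of_nonneg]
      · linarith [Real.one_sub_le_exp_neg (h p)]
      · linarith [Real.exp_le_one_iff.2 (neg_nonpos.2 (h0 p))]
    have h3 : ∫ p : (ℝ × ℝ) × Ioi (0 : ℝ), (Real.exp (-(p.2 * f p.1)) - 1 + p.2 * f p.1)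
        ∂(volume.prod σ) = ∫ p, (Real.exp (-h p) - 1) ∂(volume.prod σ) + c := by
      rw [← hch, ← integral_add hint hi]
      refine integral_congr_ae (hae.mono fun p hp => ?_)
      simp only [hp]
    rw [h3, Real.exp_add, ← hlap, mul_assoc, ← Real.exp_add]
    simp

lemma exp_neg_sub_one_add_mono {a b : ℝ} (ha : 0 ≤ a) (hab : a ≤ b) :
    Real.exp (-a) - 1 + a ≤ Real.exp (-b) - 1 + b := by
  have h1 : Real.exp (-a) * (1 - Real.exp (a - b)) ≤ 1 * (b - a) := by
    refine mul_le_mul (Real.exp_le_one_iff.2 (by linarith)) ?_ ?_ zero_le_one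
    · linarith [Real.add_one_le_exp (a - b)]
    · linarith [Real.exp_le_one_iff.2 (show a - b ≤ 0 by linarith)]
  rw [mul_sub, ← Real.exp_add] at h1
  rw [show -a + (a - b) = -b by ring] at h1
  linarith

/-- The Laplace transform of the centered noise is increasing, because `e^{-a} - 1 + a` is. -/
lemma integral_exp_neg_pairing_mono
    (hσ2 : Integrable (fun τ : Ioi (0 : ℝ) => (τ : ℝ) ^ 2) σ)
    (hσ1 : Integrable (fun τ : Ioi (0 : ℝ) => (τ : ℝ)) σ)
    (hν : IsCenteredLevyNoise σ ν) (hT : IsPairingExtension ν T)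
    {f g : Lp ℝ 2 (volume : Measure (ℝ × ℝ))} (hf0 : 0 ≤ f) (hfg : f ≤ g)
    (hgi : Integrable g volume) :
    ∫ ω, Real.exp (-T f ω) ∂ν ≤ ∫ ω, Real.exp (-T g ω) ∂ν := by
  have hf0' := (Lp.coeFn_nonneg f).2 hf0
  have hfg' := (Lp.coeFn_le f g).2 hfg
  have hfi : Integrable f volume := by
    refine hgi.mono' (Lp.aestronglyMeasurable f) ?_
    filter_upwards [hf0', hfg'] with z h1 h2
    rwa [Real.norm_of_nonneg h1]
  rw [(pairing_nonneg_and_laplace hσ2 hσ1 hν hT hf0 hfi).2,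
    (pairing_nonneg_and_laplace hσ2 hσ1 hν hT (hf0.trans hfg) hgi).2, Real.exp_le_exp]
  have hint : ∀ {u : Lp ℝ 2 (volume : Measure (ℝ × ℝ))}, 0 ≤ᵐ[volume] u → Integrable u volume →
      Integrable (fun p : (ℝ × ℝ) × Ioi (0 : ℝ) =>
        Real.exp (-(p.2 * u p.1)) - 1 + p.2 * u p.1) (volume.prod σ) := by
    intro u hu hui
    have hup : Integrable (fun p : (ℝ × ℝ) × Ioi (0 : ℝ) => (p.2 : ℝ) * u p.1)
        (volume.prod σ) := by
      refine (hui.mul_prod hσ1).congr (ae_of_all _ fun p => ?_)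
      exact mul_comm _ _
    refine hup.mono' ?_ ?_
    · have hc : Continuous fun a : ℝ => Real.exp (-a) - 1 + a := by fun_prop
      exact hc.comp_aestronglyMeasurable hup.1
    · filter_upwards [Measure.quasiMeasurePreserving_fst.ae hu] with p hp
      have hp0 : 0 ≤ (p.2 : ℝ) * u p.1 :=
        mul_nonneg (le_of_lt (show (0 : ℝ) < p.2 from p.2.2)) hp
      rw [Real.norm_of_nonneg (by linarith [Real.one_sub_le_exp_neg ((p.2 : ℝ) * u p.1)])]
      linarith [Real.exp_le_one_iff.2 (neg_nonpos.2 hp0)]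
  refine integral_mono_ae (hint hf0' hfi) (hint (hf0'.trans hfg') hgi) ?_
  filter_upwards [Measure.quasiMeasurePreserving_fst.ae hf0',
    Measure.quasiMeasurePreserving_fst.ae hfg'] with p h1 h2
  have hp : 0 ≤ (p.2 : ℝ) := le_of_lt (show (0 : ℝ) < p.2 from p.2.2)
  exact exp_neg_sub_one_add_mono (mul_nonneg hp h1) (mul_le_mul_of_nonneg_left h2 hp)

end Positive

/-! ### The kernels `1_{[0,s]}(x) 1_{[0,t]}(y) ϰ(x,y)` -/

/-- `ϰ : [0, ∞)² → [0, ∞)` is measurable and locally bounded; nothing is asked of `ϰ` outside the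
closed quadrant. -/
structure IsVolatility (κ : ℝ × ℝ → ℝ) : Prop where
  measurable : Measurable ((Ici (0 : ℝ) ×ˢ Ici (0 : ℝ)).domRestrict κ)
  nonneg : ∀ x y : ℝ, 0 ≤ x → 0 ≤ y → 0 ≤ κ (x, y)
  bdd : ∀ T : ℝ, ∃ C : ℝ, ∀ x ∈ Icc 0 T, ∀ y ∈ Icc 0 T, κ (x, y) ≤ C

/-- The kernel `1_{[0,s]}(x) 1_{[0,t]}(y) ϰ(x,y)`. -/
noncomputable def kernel (κ : ℝ × ℝ → ℝ) (s t : ℝ) : ℝ × ℝ → ℝ :=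
  (Icc 0 s ×ˢ Icc 0 t).indicator κ

/-- The constant `C` on the square `[0,T]²`, zero outside. -/
noncomputable def squareConst (C T : ℝ) : ℝ × ℝ → ℝ :=
  (Icc 0 T ×ˢ Icc 0 T).indicator fun _ => C

lemma measure_square_ne_top (T : ℝ) :
    (volume : Measure (ℝ × ℝ)) (Icc 0 T ×ˢ Icc 0 T) ≠ ⊤ :=
  (isCompact_Icc.prod isCompact_Icc).measure_lt_top.ne

lemma memLp_squareConst (C T : ℝ) (p : ℝ≥0∞) : MemLp (squareConst C T) p volume :=
  memLp_indicator_const p (measurableSet_Icc.prod measurableSet_Icc) C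
    (Or.inr (measure_square_ne_top T))

namespace IsVolatility

variable {κ : ℝ × ℝ → ℝ}

lemma measurable_kernel (hκ : IsVolatility κ) (s t : ℝ) : Measurable (kernel κ s t) := by
  have h1 : Measurable ((Ici (0 : ℝ) ×ˢ Ici (0 : ℝ)).indicator κ) := by
    have hQ : MeasurableSet (Ici (0 : ℝ) ×ˢ Ici (0 : ℝ)) := measurableSet_Ici.prod measurableSet_Ici
    refine measurable_of_restrict_of_restrict_compl hQ ?_ ?_
    · convert hκ.measurable using 1
      ext z
      exact indicator_of_mem z.2 κ
    · convert measurable_const (a := (0 : ℝ)) using 1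
      ext z
      exact indicator_of_notMem z.2 κ
  have h2 : kernel κ s t =
      (Icc 0 s ×ˢ Icc 0 t).indicator ((Ici (0 : ℝ) ×ˢ Ici (0 : ℝ)).indicator κ) := by
    rw [indicator_indicator, inter_eq_left.2]
    · rfl
    · exact prod_mono Icc_subset_Ici_self Icc_subset_Ici_self
  rw [h2]
  exact h1.indicator (measurableSet_Icc.prod measurableSet_Icc)

lemma kernel_nonneg (hκ : IsVolatility κ) (s t : ℝ) (z : ℝ × ℝ) : 0 ≤ kernel κ s t z :=
  indicator_nonneg (fun z hz => hκ.nonneg z.1 z.2 hz.1.1 hz.2.1) z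

lemma kernel_mono (hκ : IsVolatility κ) {s t s' t' : ℝ} (hs : s ≤ s') (ht : t ≤ t') (z : ℝ × ℝ) :
    kernel κ s t z ≤ kernel κ s' t' z := by
  by_cases hz : z ∈ Icc 0 s ×ˢ Icc 0 t
  · have hz' : z ∈ Icc 0 s' ×ˢ Icc 0 t' :=
      prod_mono (Icc_subset_Icc_right hs) (Icc_subset_Icc_right ht) hz
    rw [kernel, kernel, indicator_of_mem hz, indicator_of_mem hz']
  · rw [kernel, indicator_of_notMem hz]
    exact hκ.kernel_nonneg s' t' z

lemma exists_bound (hκ : IsVolatility κ) (T : ℝ) :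
    ∃ C : ℝ, 0 ≤ C ∧ ∀ s t, s ≤ T → t ≤ T → ∀ z, kernel κ s t z ≤ squareConst C T z := by
  obtain ⟨C, hC⟩ := hκ.bdd T
  refine ⟨max C 0, le_max_right _ _, fun s t hs ht z => ?_⟩
  refine (hκ.kernel_mono hs ht z).trans ?_
  refine indicator_le_indicator' fun hz => ?_
  exact (hC z.1 hz.1 z.2 hz.2).trans (le_max_left _ _)

lemma memLp_kernel (hκ : IsVolatility κ) (s t : ℝ) (p : ℝ≥0∞) : MemLp (kernel κ s t) p volume := by
  obtain ⟨C, -, hC⟩ := hκ.exists_bound (max s t)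
  refine (memLp_squareConst C (max s t) p).mono' (hκ.measurable_kernel s t).aestronglyMeasurable
    (ae_of_all _ fun z => ?_)
  rw [Real.norm_of_nonneg (hκ.kernel_nonneg s t z)]
  exact hC s t (le_max_left _ _) (le_max_right _ _) z

lemma integrable_kernel (hκ : IsVolatility κ) (s t : ℝ) : Integrable (kernel κ s t) volume :=
  memLp_one_iff_integrable.1 (hκ.memLp_kernel s t 1)

/-- The kernel as an element of `L²(ℝ²)`. -/
noncomputable def kernelLp (hκ : IsVolatility κ) (s t : ℝ) :
    Lp ℝ 2 (volume : Measure (ℝ × ℝ)) := (hκ.memLp_kernel s t 2).toLp _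

lemma coeFn_kernelLp (hκ : IsVolatility κ) (s t : ℝ) :
    hκ.kernelLp s t =ᵐ[volume] kernel κ s t := MemLp.coeFn_toLp _

lemma kernelLp_mono (hκ : IsVolatility κ) {s t s' t' : ℝ} (hs : s ≤ s') (ht : t ≤ t') :
    hκ.kernelLp s t ≤ hκ.kernelLp s' t' := by
  rw [← Lp.coeFn_le]
  filter_upwards [hκ.coeFn_kernelLp s t, hκ.coeFn_kernelLp s' t'] with z h1 h2
  rw [h1, h2]
  exact hκ.kernel_mono hs ht z

lemma kernelLp_nonneg (hκ : IsVolatility κ) (s t : ℝ) : 0 ≤ hκ.kernelLp s t := by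
  rw [← Lp.coeFn_nonneg]
  filter_upwards [hκ.coeFn_kernelLp s t] with z h1
  rw [h1]
  exact hκ.kernel_nonneg s t z

lemma integral_kernelLp (hκ : IsVolatility κ) (s t : ℝ) :
    ∫ z, hκ.kernelLp s t z = ∫ z, kernel κ s t z :=
  integral_congr_ae (hκ.coeFn_kernelLp s t)

lemma integrable_kernelLp (hκ : IsVolatility κ) (s t : ℝ) :
    Integrable (hκ.kernelLp s t) volume :=
  (hκ.integrable_kernel s t).congr (hκ.coeFn_kernelLp s t).symm

/-- For `s = 0` the kernel lives on a segment, a null set. -/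
lemma kernelLp_zero_left (hκ : IsVolatility κ) (t : ℝ) : hκ.kernelLp 0 t = 0 := by
  refine Lp.ext ?_
  have h : ∀ᵐ z : ℝ × ℝ, z.1 ≠ 0 :=
    Measure.quasiMeasurePreserving_fst.ae (Measure.ae_ne volume (0 : ℝ))
  filter_upwards [hκ.coeFn_kernelLp 0 t, Lp.coeFn_zero ℝ 2 (volume : Measure (ℝ × ℝ)), h]
    with z h1 h2 h3
  rw [h1, h2, kernel, indicator_of_notMem]
  · rfl
  · rintro ⟨hz, -⟩
    exact h3 (le_antisymm hz.2 hz.1)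

lemma eventually_kernel_eq {s t : ℝ} {z : ℝ × ℝ} (h1 : z.1 ≠ s) (h2 : z.2 ≠ t) :
    ∀ᶠ p : ℝ × ℝ in 𝓝 (s, t), kernel κ p.1 p.2 z = kernel κ s t z := by
  have key : ∀ {a b : ℝ}, a ≠ b → ∀ᶠ b' in 𝓝 b, (a ≤ b' ↔ a ≤ b) := by
    intro a b hab
    rcases hab.lt_or_gt with h | h
    · filter_upwards [lt_mem_nhds h] with b' hb'
      exact iff_of_true hb'.le h.le
    · filter_upwards [gt_mem_nhds h] with b' hb'
      exact iff_of_false hb'.not_ge h.not_ge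
  have e1 := (continuous_fst.tendsto (s, t)).eventually (key h1)
  have e2 := (continuous_snd.tendsto (s, t)).eventually (key h2)
  filter_upwards [e1, e2] with p hp1 hp2
  have hiff : z ∈ Icc 0 p.1 ×ˢ Icc 0 p.2 ↔ z ∈ Icc 0 s ×ˢ Icc 0 t := by
    simp only [mem_prod, mem_Icc, hp1, hp2]
  by_cases hz : z ∈ Icc 0 s ×ˢ Icc 0 t
  · rw [kernel, kernel, indicator_of_mem hz, indicator_of_mem (hiff.2 hz)]
  · rw [kernel, kernel, indicator_of_notMem hz, indicator_of_notMem (fun h => hz (hiff.1 h))]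

lemma ae_tendsto_kernel (s t : ℝ) : ∀ᵐ z : ℝ × ℝ,
    Tendsto (fun p : ℝ × ℝ => kernel κ p.1 p.2 z) (𝓝 (s, t)) (𝓝 (kernel κ s t z)) := by
  have h1 : ∀ᵐ z : ℝ × ℝ, z.1 ≠ s :=
    Measure.quasiMeasurePreserving_fst.ae (Measure.ae_ne volume s)
  have h2 : ∀ᵐ z : ℝ × ℝ, z.2 ≠ t :=
    Measure.quasiMeasurePreserving_snd.ae (Measure.ae_ne volume t)
  filter_upwards [h1, h2] with z h1 h2
  exact tendsto_const_nhds.congr' ((eventually_kernel_eq h1 h2).mono fun p hp => hp.symm)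

lemma eventually_le_squareConst (hκ : IsVolatility κ) (s t : ℝ) :
    ∃ C T : ℝ, ∀ᶠ p : ℝ × ℝ in 𝓝 (s, t), ∀ z, kernel κ p.1 p.2 z ≤ squareConst C T z := by
  obtain ⟨C, -, hC⟩ := hκ.exists_bound (max s t + 1)
  refine ⟨C, max s t + 1, ?_⟩
  filter_upwards [(continuous_fst.tendsto (s, t)).eventually
      (gt_mem_nhds (show s < max s t + 1 by linarith [le_max_left s t])),
    (continuous_snd.tendsto (s, t)).eventually
      (gt_mem_nhds (show t < max s t + 1 by linarith [le_max_right s t]))] with p h1 h2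
  exact hC _ _ (le_of_lt h1) (le_of_lt h2)

lemma continuous_integral_kernel (hκ : IsVolatility κ) :
    Continuous fun p : ℝ × ℝ => ∫ z, kernel κ p.1 p.2 z := by
  rw [continuous_iff_continuousAt]
  rintro ⟨s, t⟩
  obtain ⟨C, T, hCT⟩ := hκ.eventually_le_squareConst s t
  refine tendsto_integral_filter_of_dominated_convergence (squareConst C T)
    (Eventually.of_forall fun p => (hκ.measurable_kernel _ _).aestronglyMeasurable) ?_
    (memLp_one_iff_integrable.1 (memLp_squareConst C T 1)) (ae_tendsto_kernel s t)
  filter_upwards [hCT] with p hp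
  refine ae_of_all _ fun z => ?_
  rw [Real.norm_of_nonneg (hκ.kernel_nonneg _ _ z)]
  exact hp z

lemma continuous_kernelLp (hκ : IsVolatility κ) :
    Continuous fun p : ℝ × ℝ => hκ.kernelLp p.1 p.2 := by
  rw [continuous_iff_continuousAt]
  rintro ⟨s, t⟩
  obtain ⟨C, T, hCT⟩ := hκ.eventually_le_squareConst s t
  have hsq : ∀ p : ℝ × ℝ, ‖hκ.kernelLp p.1 p.2 - hκ.kernelLp s t‖ ^ 2 =
      ∫ z, (kernel κ p.1 p.2 z - kernel κ s t z) ^ 2 := by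
    intro p
    rw [← integral_sq_eq_norm_sq]
    refine integral_congr_ae ?_
    filter_upwards [Lp.coeFn_sub (hκ.kernelLp p.1 p.2) (hκ.kernelLp s t),
      hκ.coeFn_kernelLp p.1 p.2, hκ.coeFn_kernelLp s t] with z h1 h2 h3
    rw [h1, Pi.sub_apply, h2, h3]
  have hlim : Tendsto (fun p : ℝ × ℝ => ‖hκ.kernelLp p.1 p.2 - hκ.kernelLp s t‖ ^ 2)
      (𝓝 (s, t)) (𝓝 0) := by
    simp_rw [hsq]
    have h0 : (0 : ℝ) = ∫ _ : ℝ × ℝ, (0 : ℝ) := by simp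
    rw [h0]
    refine tendsto_integral_filter_of_dominated_convergence (fun z => squareConst C T z ^ 2)
      (Eventually.of_forall fun p => (((hκ.measurable_kernel _ _).sub
        (hκ.measurable_kernel _ _)).pow_const 2).aestronglyMeasurable) ?_
      (memLp_squareConst C T 2).integrable_sq ?_
    · filter_upwards [hCT] with p hp
      refine ae_of_all _ fun z => ?_
      have h1 := hp z
      have h2 := hCT.self_of_nhds z
      have h3 := hκ.kernel_nonneg p.1 p.2 z
      have h4 := hκ.kernel_nonneg s t z
      simp only at h2
      rw [Real.norm_of_nonneg (sq_nonneg _), sq_le_sq, abs_of_nonneg (h3.trans h1), abs_le]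
      constructor <;> linarith
    · filter_upwards [ae_tendsto_kernel (κ := κ) s t] with z hz
      have := (hz.sub_const (kernel κ s t z)).pow 2
      simpa using this
  rw [ContinuousAt, tendsto_iff_norm_sub_tendsto_zero]
  have := hlim.sqrt
  simpa [Real.sqrt_sq (norm_nonneg _)] using this

/-- The order of integration is that of the condition on the initial term structure. -/
lemma integral_kernel_eq (hκ : IsVolatility κ) {t : ℝ} (ht : 0 ≤ t) :
    ∫ z, kernel κ t t z = ∫ y in (0 : ℝ)..t, ∫ x in (0 : ℝ)..t, κ (x, y) := by
  have h := integral_prod_symm (kernel κ t t)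
    (by rw [← Measure.volume_eq_prod]; exact hκ.integrable_kernel t t)
  rw [← Measure.volume_eq_prod] at h
  rw [h, intervalIntegral.integral_of_le ht, ← integral_Icc_eq_integral_Ioc,
    ← integral_indicator measurableSet_Icc]
  refine integral_congr_ae (ae_of_all _ fun y => ?_)
  simp only
  by_cases hy : y ∈ Icc 0 t
  · rw [indicator_of_mem hy, intervalIntegral.integral_of_le ht, ← integral_Icc_eq_integral_Ioc,
      ← integral_indicator measurableSet_Icc]
    refine integral_congr_ae (ae_of_all _ fun x => ?_)
    by_cases hx : x ∈ Icc 0 t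
    · simp only
      rw [indicator_of_mem hx, kernel,
        indicator_of_mem (show (x, y) ∈ Icc 0 t ×ˢ Icc 0 t from ⟨hx, hy⟩)]
    · simp only
      rw [indicator_of_notMem hx, kernel, indicator_of_notMem (fun h => hx h.1)]
  · rw [indicator_of_notMem hy]
    refine integral_eq_zero_of_ae (ae_of_all _ fun x => ?_)
    exact indicator_of_notMem (fun h : (x, y) ∈ Icc 0 t ×ˢ Icc 0 t => hy h.2) κ

end IsVolatility

/-! ### The drift forced by the martingale property -/

/-- A function continuous on `[s, ∞)` whose integrals over all `[t, t']` are nonnegative is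
nonnegative at `t`. -/
lemma nonneg_of_integral_nonneg {g : ℝ → ℝ} {s t : ℝ} (hst : s ≤ t) (hg : ContinuousOn g (Ici s))
    (h : ∀ t', t ≤ t' → 0 ≤ ∫ u in t..t', g u) : 0 ≤ g t := by
  by_contra hneg
  push Not at hneg
  have hev : ∀ᶠ u in 𝓝[Ici s] t, g u < g t / 2 :=
    (hg t hst).eventually_lt_const (by linarith)
  obtain ⟨δ, hδ, hball⟩ := Metric.mem_nhdsWithin_iff.1 hev
  set t' := t + δ / 2 with ht'
  have htt' : t ≤ t' := by linarith
  have hle : ∫ u in t..t', g u ≤ ∫ _ in t..t', g t / 2 := by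
    refine intervalIntegral.integral_mono_on htt' ?_ (by simp) fun u hu => ?_
    · refine (hg.mono ?_).intervalIntegrable
      rw [uIcc_of_le htt']
      exact fun u hu => hst.trans hu.1
    · refine le_of_lt (hball ⟨?_, hst.trans hu.1⟩)
      rw [Metric.mem_ball, Real.dist_eq, abs_of_nonneg (by linarith [hu.1])]
      linarith [hu.2]
  have h0 := h t' htt'
  rw [intervalIntegral.integral_const, smul_eq_mul] at hle
  have : (t' - t) * (g t / 2) < 0 := mul_neg_of_pos_of_neg (by linarith) (by linarith)
  linarith

section Drift

variable {ν : Measure Dist} [IsProbabilityMeasure ν] {κ : ℝ × ℝ → ℝ} {μ : ℝ → ℝ → ℝ}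
  {T : Lp ℝ 2 (volume : Measure (ℝ × ℝ)) →L[ℝ] Lp ℝ 2 ν}

lemma forwardRate_eq (hκ : IsVolatility κ) (hT : IsPairingExtension ν T) (s t : ℝ) :
    forwardRate ν κ μ s t = Lp.constL 2 ν ℝ (μ s t) + T (hκ.kernelLp s t) := by
  rw [forwardRate, field]
  congr 1
  exact pairing_eq hT (hκ.memLp_kernel s t 2)

lemma coeFn_forwardRate (hκ : IsVolatility κ) (hT : IsPairingExtension ν T) (s t : ℝ) :
    forwardRate ν κ μ s t =ᵐ[ν] fun ω => μ s t + T (hκ.kernelLp s t) ω := by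
  rw [forwardRate_eq hκ hT]
  filter_upwards [Lp.coeFn_add (Lp.constL 2 ν ℝ (μ s t)) (T (hκ.kernelLp s t)),
    Lp.coeFn_const (p := 2) (μ := ν) (c := μ s t)] with ω h1 h2
  rw [h1, Pi.add_apply]
  congr 1

lemma integral_forwardRate (hκ : IsVolatility κ) (hT : IsPairingExtension ν T) {a b : ℝ}
    {i : ℝ → ℝ} (hi : Continuous i) (hμ : IntervalIntegrable (fun u => μ (i u) u) volume a b) :
    ∫ u in a..b, forwardRate ν κ μ (i u) u =
      Lp.constL 2 ν ℝ (∫ u in a..b, μ (i u) u) + T (∫ u in a..b, hκ.kernelLp (i u) u) := by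
  have hk : IntervalIntegrable (fun u => hκ.kernelLp (i u) u) volume a b :=
    (hκ.continuous_kernelLp.comp (hi.prodMk continuous_id)).intervalIntegrable a b
  have h1 := (Lp.constL 2 ν ℝ).intervalIntegral_comp_comm hμ
  have h2 := T.intervalIntegral_comp_comm hk
  rw [← h1, ← h2, ← intervalIntegral.integral_add]
  · simp only [forwardRate_eq hκ hT]
  · exact ⟨ContinuousLinearMap.integrable_comp (μ := volume.restrict _) _ hμ.1,
      ContinuousLinearMap.integrable_comp (μ := volume.restrict _) _ hμ.2⟩
  · exact ⟨ContinuousLinearMap.integrable_comp (μ := volume.restrict _) T hk.1,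
      ContinuousLinearMap.integrable_comp (μ := volume.restrict _) T hk.2⟩

/-- The deterministic part of the exponent of the discounted bond price. -/
noncomputable def meanExponent (μ : ℝ → ℝ → ℝ) (s t : ℝ) : ℝ :=
  (∫ u in s..t, μ s u) + ∫ u in (0 : ℝ)..s, μ u u

/-- The kernel whose pairing with the noise is the random part of the exponent of the discounted
bond price. -/
noncomputable def bondKernel (hκ : IsVolatility κ) (s t : ℝ) :
    Lp ℝ 2 (volume : Measure (ℝ × ℝ)) :=
  (∫ u in s..t, hκ.kernelLp s u) + ∫ u in (0 : ℝ)..s, hκ.kernelLp u u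

lemma continuousOn_mean_right
    (hμ : ContinuousOn (fun p : ℝ × ℝ => μ p.1 p.2) {p | 0 ≤ p.1 ∧ p.1 ≤ p.2})
    {s : ℝ} (hs : 0 ≤ s) : ContinuousOn (fun u => μ s u) (Ici s) :=
  hμ.comp (f := fun u : ℝ => (s, u)) (by fun_prop) fun _ hu => ⟨hs, hu⟩

lemma continuousOn_mean_diag
    (hμ : ContinuousOn (fun p : ℝ × ℝ => μ p.1 p.2) {p | 0 ≤ p.1 ∧ p.1 ≤ p.2}) :
    ContinuousOn (fun u => μ u u) (Ici 0) :=
  hμ.comp (f := fun u : ℝ => (u, u)) (by fun_prop) fun _ hu => ⟨hu, le_rfl⟩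

lemma intervalIntegrable_of_continuousOn_Ici {g : ℝ → ℝ} {s a b : ℝ}
    (hg : ContinuousOn g (Ici s)) (ha : s ≤ a) (hb : s ≤ b) :
    IntervalIntegrable g volume a b :=
  (hg.mono fun _ hu => (le_min ha hb).trans hu.1).intervalIntegrable

lemma discountedBondPrice_ae_eq (hκ : IsVolatility κ) (hT : IsPairingExtension ν T)
    (hμ : ContinuousOn (fun p : ℝ × ℝ => μ p.1 p.2) {p | 0 ≤ p.1 ∧ p.1 ≤ p.2})
    {s t : ℝ} (hs : 0 ≤ s) (hst : s ≤ t) :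
    discountedBondPrice ν κ μ s t =ᵐ[ν] fun ω =>
      Real.exp (-meanExponent μ s t) * Real.exp (-T (bondKernel hκ s t) ω) := by
  have h1 := integral_forwardRate (μ := μ) hκ hT (a := s) (b := t) (i := fun _ => s)
    continuous_const
    (intervalIntegrable_of_continuousOn_Ici (continuousOn_mean_right hμ hs) le_rfl hst)
  have h2 := integral_forwardRate (μ := μ) hκ hT (a := 0) (b := s) (i := fun u => u)
    continuous_id
    (intervalIntegrable_of_continuousOn_Ici (continuousOn_mean_diag hμ) le_rfl hs)
  have hcoe : ∀ (c : ℝ) (f : Lp ℝ 2 (volume : Measure (ℝ × ℝ))),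
      ((Lp.constL 2 ν ℝ c + T f : Lp ℝ 2 ν) : Dist → ℝ) =ᵐ[ν] fun ω => c + T f ω := by
    intro c f
    filter_upwards [Lp.coeFn_add (Lp.constL 2 ν ℝ c) (T f),
      Lp.coeFn_const (p := 2) (μ := ν) (c := c)] with ω h1 h2
    rw [h1, Pi.add_apply]
    congr 1
  have h3 := hcoe (∫ u in s..t, μ s u) (∫ u in s..t, hκ.kernelLp s u)
  have h4 := hcoe (∫ u in (0 : ℝ)..s, μ u u) (∫ u in (0 : ℝ)..s, hκ.kernelLp u u)
  rw [← h1] at h3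
  rw [← h2] at h4
  have h5 := Lp.coeFn_add (T (∫ u in s..t, hκ.kernelLp s u))
    (T (∫ u in (0 : ℝ)..s, hκ.kernelLp u u))
  rw [← map_add] at h5
  filter_upwards [h3, h4, h5] with ω h3 h4 h5
  simp only [discountedBondPrice, bondPrice, spotRate]
  rw [h3, h4, bondKernel, h5, Pi.add_apply, meanExponent, ← Real.exp_add, ← Real.exp_add]
  congr 1
  ring

lemma intervalIntegrable_kernelLp (hκ : IsVolatility κ) (s a b : ℝ) :
    IntervalIntegrable (fun u => hκ.kernelLp s u) volume a b :=
  (hκ.continuous_kernelLp.comp (continuous_const.prodMk continuous_id)).intervalIntegrable a b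

lemma intervalIntegrable_kernelLp_diag (hκ : IsVolatility κ) (a b : ℝ) :
    IntervalIntegrable (fun u => hκ.kernelLp u u) volume a b :=
  (hκ.continuous_kernelLp.comp (continuous_id.prodMk continuous_id)).intervalIntegrable a b

/-- This makes the monotonicity of the Bochner integral available for `L²`-valued functions. -/
instance isOrderedModule_Lp {α : Type*} [MeasurableSpace α] {m : Measure α} :
    IsOrderedModule ℝ (Lp ℝ 2 m) :=
  .of_smul_nonneg fun c hc f hf => by
    rw [← Lp.coeFn_nonneg] at hf ⊢
    filter_upwards [hf, Lp.coeFn_smul c f] with x h1 h2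
    rw [h2]
    exact mul_nonneg hc h1

lemma Lp_intervalIntegral_nonneg {k : ℝ → Lp ℝ 2 (volume : Measure (ℝ × ℝ))} {a b : ℝ}
    (hab : a ≤ b) (hk : ∀ u, 0 ≤ k u) : 0 ≤ ∫ u in a..b, k u := by
  rw [intervalIntegral.integral_of_le hab]
  exact integral_nonneg hk

lemma bondKernel_nonneg (hκ : IsVolatility κ) {s t : ℝ} (hs : 0 ≤ s) (hst : s ≤ t) :
    0 ≤ bondKernel hκ s t :=
  add_nonneg (Lp_intervalIntegral_nonneg hst fun u => hκ.kernelLp_nonneg s u)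
    (Lp_intervalIntegral_nonneg hs fun u => hκ.kernelLp_nonneg u u)

lemma bondKernel_mono (hκ : IsVolatility κ) {s t t' : ℝ} (htt' : t ≤ t') :
    bondKernel hκ s t ≤ bondKernel hκ s t' := by
  rw [bondKernel, bondKernel, add_le_add_iff_right,
    ← intervalIntegral.integral_add_adjacent_intervals (intervalIntegrable_kernelLp hκ s s t)
      (intervalIntegrable_kernelLp hκ s t t')]
  exact le_add_of_nonneg_right (Lp_intervalIntegral_nonneg htt' fun u => hκ.kernelLp_nonneg s u)

lemma Lp_intervalIntegral_le {k : ℝ → Lp ℝ 2 (volume : Measure (ℝ × ℝ))}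
    {B : Lp ℝ 2 (volume : Measure (ℝ × ℝ))} {a b : ℝ} (hab : a ≤ b)
    (hki : IntervalIntegrable k volume a b) (hk : ∀ u ∈ Ioc a b, k u ≤ B) :
    ∫ u in a..b, k u ≤ (b - a) • B := by
  rw [← intervalIntegral.integral_const, intervalIntegral.integral_of_le hab,
    intervalIntegral.integral_of_le hab]
  refine integral_mono_ae hki.1 (integrable_const _) ?_
  exact (ae_restrict_iff' measurableSet_Ioc).2 (ae_of_all _ hk)

/-- The kernel of the bond price is bounded by a constant on a square, so it lies in `L¹`. -/
lemma integrable_bondKernel (hκ : IsVolatility κ) {s t : ℝ} (hs : 0 ≤ s) (hst : s ≤ t) :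
    Integrable (bondKernel hκ s t) volume := by
  obtain ⟨C, -, hC⟩ := hκ.exists_bound t
  set B := (memLp_squareConst C t 2).toLp with hB
  have hle : ∀ a b, a ≤ t → b ≤ t → hκ.kernelLp a b ≤ B := by
    intro a b ha hb
    rw [← Lp.coeFn_le]
    filter_upwards [hκ.coeFn_kernelLp a b, (memLp_squareConst C t 2).coeFn_toLp] with z h1 h2
    rw [h1, h2]
    exact hC a b ha hb z
  have h1 : bondKernel hκ s t ≤ (t - s) • B + (s - 0) • B :=
    add_le_add
      (Lp_intervalIntegral_le hst (intervalIntegrable_kernelLp hκ s s t)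
        fun u hu => hle s u hst hu.2)
      (Lp_intervalIntegral_le hs (intervalIntegrable_kernelLp_diag hκ 0 s)
        fun u hu => hle u u (hu.2.trans hst) (hu.2.trans hst))
  rw [← add_smul, ← Lp.coeFn_le] at h1
  have h0 := (Lp.coeFn_nonneg _).2 (bondKernel_nonneg hκ hs hst)
  refine ((memLp_one_iff_integrable.1 (memLp_squareConst C t 1)).const_mul
    (t - s + (s - 0))).mono' (Lp.aestronglyMeasurable _) ?_
  filter_upwards [h0, h1, Lp.coeFn_smul (t - s + (s - 0)) B,
    (memLp_squareConst C t 2).coeFn_toLp] with z h0 h1 h2 h3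
  rw [Real.norm_of_nonneg h0]
  refine h1.trans_eq ?_
  rw [h2, Pi.smul_apply, h3, smul_eq_mul]

lemma bondKernel_zero_left (hκ : IsVolatility κ) (t : ℝ) : bondKernel hκ 0 t = 0 := by
  simp [bondKernel, hκ.kernelLp_zero_left]

/-- The expectation of the discounted bond price at time `s` equals its value at time `0`, which is
deterministic. -/
lemma integral_exp_neg_bondKernel (hκ : IsVolatility κ) (hT : IsPairingExtension ν T)
    (hμ : ContinuousOn (fun p : ℝ × ℝ => μ p.1 p.2) {p | 0 ≤ p.1 ∧ p.1 ≤ p.2})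
    {t : ℝ} (hmart : Martingale (fun s : Icc (0 : ℝ) t => discountedBondPrice ν κ μ s t)
      (informationFiltration ν κ μ t) ν)
    {s : ℝ} (hs : 0 ≤ s) (hst : s ≤ t) :
    ∫ ω, Real.exp (-T (bondKernel hκ s t) ω) ∂ν =
      Real.exp (meanExponent μ s t - meanExponent μ 0 t) := by
  have ht : 0 ≤ t := hs.trans hst
  have hm : ∫ ω, discountedBondPrice ν κ μ 0 t ω ∂ν = ∫ ω, discountedBondPrice ν κ μ s t ω ∂ν := by
    have := hmart.setIntegral_eq (i := ⟨0, le_rfl, ht⟩) (j := ⟨s, hs, hst⟩)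
      (show (0 : ℝ) ≤ s from hs) (s := univ) MeasurableSet.univ
    simpa using this
  rw [integral_congr_ae (discountedBondPrice_ae_eq hκ hT hμ le_rfl ht),
    integral_congr_ae (discountedBondPrice_ae_eq hκ hT hμ hs hst), integral_const_mul,
    integral_const_mul, bondKernel_zero_left, map_zero] at hm
  have h0 : ∫ ω, Real.exp (-((0 : Lp ℝ 2 ν) : Dist → ℝ) ω) ∂ν = 1 := by
    have : ∀ᵐ ω ∂ν, Real.exp (-((0 : Lp ℝ 2 ν) : Dist → ℝ) ω) = 1 := by
      filter_upwards [Lp.coeFn_zero ℝ 2 ν] with ω hω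
      rw [hω]; simp
    rw [integral_congr_ae this]; simp
  rw [h0, mul_one] at hm
  rw [sub_eq_add_neg, Real.exp_add, hm, ← mul_assoc, ← Real.exp_add]
  simp

/-- The martingale property forces the mean of the forward rates to lie above the initial term
structure: `t ↦ exp (∫_s^t (μ_{s,u} - μ_{0,u}) du)` is, up to a constant factor, the Laplace
transform of the pairing with a kernel increasing in `t`. -/
theorem initial_le_mean {σ : Measure (Ioi (0 : ℝ))} [SFinite σ]
    (hσ2 : Integrable (fun τ : Ioi (0 : ℝ) => (τ : ℝ) ^ 2) σ)
    (hσ1 : Integrable (fun τ : Ioi (0 : ℝ) => (τ : ℝ)) σ)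
    (hν : IsCenteredLevyNoise σ ν) (hκ : IsVolatility κ) (hT : IsPairingExtension ν T)
    (hμ : ContinuousOn (fun p : ℝ × ℝ => μ p.1 p.2) {p | 0 ≤ p.1 ∧ p.1 ≤ p.2})
    (hmart : ∀ t : ℝ, 0 ≤ t →
      Martingale (fun s : Icc (0 : ℝ) t => discountedBondPrice ν κ μ s t)
        (informationFiltration ν κ μ t) ν)
    {s t : ℝ} (hs : 0 ≤ s) (hst : s ≤ t) : μ 0 t ≤ μ s t := by
  have hc0 := continuousOn_mean_right hμ le_rfl
  have hcs := continuousOn_mean_right hμ hs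
  rw [← sub_nonneg]
  refine nonneg_of_integral_nonneg (g := fun u => μ s u - μ 0 u) hst
    (hcs.sub (hc0.mono (Ici_subset_Ici.2 hs))) fun t' htt' => ?_
  have ht : 0 ≤ t := hs.trans hst
  have h1 := integral_exp_neg_pairing_mono hσ2 hσ1 hν hT (bondKernel_nonneg hκ hs hst)
    (bondKernel_mono hκ htt') (integrable_bondKernel hκ hs (hst.trans htt'))
  rw [integral_exp_neg_bondKernel hκ hT hμ (hmart t ht) hs hst,
    integral_exp_neg_bondKernel hκ hT hμ (hmart t' (ht.trans htt')) hs (hst.trans htt'),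
    Real.exp_le_exp] at h1
  have i1 : ∀ {a b : ℝ}, s ≤ a → s ≤ b → IntervalIntegrable (fun u => μ s u) volume a b :=
    intervalIntegrable_of_continuousOn_Ici hcs
  have i0 : ∀ {a b : ℝ}, 0 ≤ a → 0 ≤ b → IntervalIntegrable (fun u => μ 0 u) volume a b :=
    intervalIntegrable_of_continuousOn_Ici hc0
  have e1 := intervalIntegral.integral_add_adjacent_intervals (i1 le_rfl hst)
    (i1 hst (hst.trans htt'))
  have e0 := intervalIntegral.integral_add_adjacent_intervals (i0 le_rfl ht)
    (i0 ht (ht.trans htt'))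
  rw [intervalIntegral.integral_sub (i1 hst (hst.trans htt')) (i0 ht (ht.trans htt'))]
  simp only [meanExponent] at h1
  linarith

end Drift

/-! ### Right-continuous versions of fields with nonnegative increments -/

section RightInf

variable {Ω : Type*}

/-- The infimum of the positive parts `A_{s',t'}⁺` over all rational `s' > s`, `t' > t`. -/
noncomputable def rightInf (A : ℝ → ℝ → Ω → ℝ) (s t : ℝ) (ω : Ω) : ℝ :=
  ⨅ q : {q : ℚ × ℚ // s < q.1 ∧ t < q.2}, max (A (q : ℚ × ℚ).1 (q : ℚ × ℚ).2 ω) 0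

lemma nonempty_rat_above (s t : ℝ) : Nonempty {q : ℚ × ℚ // s < q.1 ∧ t < q.2} := by
  obtain ⟨a, ha⟩ := exists_rat_gt s
  obtain ⟨b, hb⟩ := exists_rat_gt t
  exact ⟨⟨(a, b), ha, hb⟩⟩

lemma bddBelow_posPart (A : ℝ → ℝ → Ω → ℝ) (s t : ℝ) (ω : Ω) :
    BddBelow (range fun q : {q : ℚ × ℚ // s < q.1 ∧ t < q.2} =>
      max (A (q : ℚ × ℚ).1 (q : ℚ × ℚ).2 ω) 0) :=
  ⟨0, by rintro _ ⟨q, rfl⟩; exact le_max_right _ _⟩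

lemma rightInf_nonneg (A : ℝ → ℝ → Ω → ℝ) (s t : ℝ) (ω : Ω) : 0 ≤ rightInf A s t ω :=
  Real.iInf_nonneg fun _ => le_max_right _ _

lemma rightInf_le (A : ℝ → ℝ → Ω → ℝ) {s t : ℝ} (ω : Ω) {q : ℚ × ℚ} (hs : s < q.1)
    (ht : t < q.2) : rightInf A s t ω ≤ max (A q.1 q.2 ω) 0 :=
  ciInf_le (bddBelow_posPart A s t ω)
    (⟨q, hs, ht⟩ : {q : ℚ × ℚ // s < q.1 ∧ t < q.2})

lemma rightInf_mono (A : ℝ → ℝ → Ω → ℝ) {s t s' t' : ℝ} (hs : s ≤ s') (ht : t ≤ t') (ω : Ω) :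
    rightInf A s t ω ≤ rightInf A s' t' ω := by
  have := nonempty_rat_above s' t'
  exact le_ciInf fun q => rightInf_le A ω (hs.trans_lt q.2.1) (ht.trans_lt q.2.2)

lemma measurable_rightInf [MeasurableSpace Ω] {A : ℝ → ℝ → Ω → ℝ}
    (hA : ∀ s t, Measurable (A s t)) (s t : ℝ) :
    Measurable (rightInf A s t) :=
  Measurable.iInf fun _ => (hA _ _).max measurable_const

lemma continuousWithinAt_rightInf (A : ℝ → ℝ → Ω → ℝ) (s t : ℝ) (ω : Ω) :
    ContinuousWithinAt (fun p : ℝ × ℝ => rightInf A p.1 p.2 ω) {p | s ≤ p.1 ∧ t ≤ p.2} (s, t) := by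
  have hne := nonempty_rat_above s t
  refine tendsto_order.2 ⟨fun a ha => ?_, fun a ha => ?_⟩
  · filter_upwards [self_mem_nhdsWithin] with p hp
    exact ha.trans_le (rightInf_mono A hp.1 hp.2 ω)
  · obtain ⟨q, hq⟩ := exists_lt_of_ciInf_lt (show ⨅ q : {q : ℚ × ℚ // s < q.1 ∧ t < q.2},
      max (A (q : ℚ × ℚ).1 (q : ℚ × ℚ).2 ω) 0 < a from ha)
    refine mem_nhdsWithin_of_mem_nhds ?_
    filter_upwards [(continuous_fst.tendsto (s, t)).eventually (gt_mem_nhds q.2.1),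
      (continuous_snd.tendsto (s, t)).eventually (gt_mem_nhds q.2.2)] with p h1 h2
    exact (rightInf_le A ω h1 h2).trans_lt hq

/-- A nonnegative field with nonnegative increments that is continuous in measure is a.s. equal to
its regularization at each fixed point. -/
lemma rightInf_ae_eq [MeasurableSpace Ω] {ν : Measure Ω}
    {A : ℝ → ℝ → Ω → ℝ} {s t : ℝ} (h0 : ∀ᵐ ω ∂ν, 0 ≤ A s t ω)
    (hmono : ∀ s' t', s ≤ s' → t ≤ t' → ∀ᵐ ω ∂ν, A s t ω ≤ A s' t' ω)
    (hcont : ∀ q : ℕ → ℝ × ℝ, Tendsto q atTop (𝓝 (s, t)) →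
      TendstoInMeasure ν (fun n => A (q n).1 (q n).2) atTop (A s t)) :
    rightInf A s t =ᵐ[ν] A s t := by
  have hne := nonempty_rat_above s t
  have hmono' : ∀ᵐ ω ∂ν, ∀ q : {q : ℚ × ℚ // s < q.1 ∧ t < q.2},
      A s t ω ≤ A (q : ℚ × ℚ).1 (q : ℚ × ℚ).2 ω :=
    ae_all_iff.2 fun q => hmono _ _ q.2.1.le q.2.2.le
  -- rational points, strictly to the upper right, converging to `(s, t)`
  have hrat : ∀ x : ℝ, ∃ r : ℕ → ℚ, (∀ n, x < r n) ∧ Tendsto (fun n => (r n : ℝ)) atTop (𝓝 x) := by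
    intro x
    choose r hr hr' using fun n : ℕ =>
      exists_rat_btwn (show x < x + 1 / (n + 1 : ℝ) from
        lt_add_of_pos_right x Nat.one_div_pos_of_nat)
    refine ⟨r, hr, tendsto_of_tendsto_of_tendsto_of_le_of_le tendsto_const_nhds ?_
      (fun n => (hr n).le) (fun n => (hr' n).le)⟩
    simpa using (tendsto_one_div_add_atTop_nhds_zero_nat (𝕜 := ℝ)).const_add x
  obtain ⟨a, ha, ha'⟩ := hrat s
  obtain ⟨b, hb, hb'⟩ := hrat t
  obtain ⟨ns, -, hns⟩ :=
    (hcont (fun n => ((a n : ℝ), (b n : ℝ))) (ha'.prodMk_nhds hb')).exists_seq_tendsto_ae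
  filter_upwards [h0, hmono', hns] with ω h0 h1 h2
  refine le_antisymm ?_ (le_ciInf fun q => (h1 q).trans (le_max_left _ _))
  have h3 : Tendsto (fun n => max (A (a (ns n)) (b (ns n)) ω) 0) atTop (𝓝 (max (A s t ω) 0)) :=
    h2.max tendsto_const_nhds
  rw [max_eq_left h0] at h3
  exact ge_of_tendsto' h3 fun n =>
    rightInf_le A ω (q := (a (ns n), b (ns n))) (ha (ns n)) (hb (ns n))

end RightInf

/-! ### Nonnegativity of the rates -/

section Rates

variable {σ : Measure (Ioi (0 : ℝ))} {ν : Measure Dist}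
  {κ : ℝ × ℝ → ℝ} {T : Lp ℝ 2 (volume : Measure (ℝ × ℝ)) →L[ℝ] Lp ℝ 2 ν}

/-- The pairing of the kernel `1_{[0,s]}(x) 1_{[0,t]}(y) ϰ(x,y)` with the uncompensated noise,
`X_{s,t} + ⟨τ⟩_σ ∫_0^s ∫_0^t ϰ`, where `T` is the extension of the noise to `L²(ℝ²)`. -/
noncomputable def jumpField (σ : Measure (Ioi (0 : ℝ))) (hκ : IsVolatility κ)
    (T : Lp ℝ 2 (volume : Measure (ℝ × ℝ)) →L[ℝ] Lp ℝ 2 ν) (s t : ℝ) (ω : Dist) : ℝ :=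
  T (hκ.kernelLp s t) ω + (∫ z, kernel κ s t z) * ∫ τ, (τ : ℝ) ∂σ

lemma measurable_jumpField (hκ : IsVolatility κ) (s t : ℝ) :
    Measurable (jumpField σ hκ T s t) :=
  (Lp.stronglyMeasurable _).measurable.add_const _

variable [IsProbabilityMeasure ν]

lemma tendstoInMeasure_jumpField (hκ : IsVolatility κ) {s t : ℝ} {q : ℕ → ℝ × ℝ}
    (hq : Tendsto q atTop (𝓝 (s, t))) :
    TendstoInMeasure ν (fun n => jumpField σ hκ T (q n).1 (q n).2) atTop
      (jumpField σ hκ T s t) := by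
  have hA : ∀ a b, ((T (hκ.kernelLp a b) + Lp.constL 2 ν ℝ
      ((∫ z, kernel κ a b z) * ∫ τ, (τ : ℝ) ∂σ) : Lp ℝ 2 ν) : Dist → ℝ) =ᵐ[ν]
        jumpField σ hκ T a b := by
    intro a b
    filter_upwards [Lp.coeFn_add (T (hκ.kernelLp a b))
        (Lp.constL 2 ν ℝ ((∫ z, kernel κ a b z) * ∫ τ, (τ : ℝ) ∂σ)),
      Lp.coeFn_const (p := 2) (μ := ν) (c := (∫ z, kernel κ a b z) * ∫ τ, (τ : ℝ) ∂σ)]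
      with ω h1 h2
    rw [h1, Pi.add_apply]
    exact congrArg _ h2
  have hc : Continuous fun p : ℝ × ℝ => T (hκ.kernelLp p.1 p.2) + Lp.constL 2 ν ℝ
      ((∫ z, kernel κ p.1 p.2 z) * ∫ τ, (τ : ℝ) ∂σ) :=
    (T.continuous.comp hκ.continuous_kernelLp).add
      ((Lp.constL 2 ν ℝ).continuous.comp (hκ.continuous_integral_kernel.mul continuous_const))
  exact (tendstoInMeasure_of_tendsto_Lp ((hc.tendsto (s, t)).comp hq)).congr
    (fun n => hA _ _) (hA s t)

variable [SFinite σ]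

lemma jumpField_nonneg (hσ2 : Integrable (fun τ : Ioi (0 : ℝ) => (τ : ℝ) ^ 2) σ)
    (hσ1 : Integrable (fun τ : Ioi (0 : ℝ) => (τ : ℝ)) σ)
    (hν : IsCenteredLevyNoise σ ν) (hκ : IsVolatility κ) (hT : IsPairingExtension ν T) (s t : ℝ) :
    ∀ᵐ ω ∂ν, 0 ≤ jumpField σ hκ T s t ω := by
  have := (pairing_nonneg_and_laplace hσ2 hσ1 hν hT (hκ.kernelLp_nonneg s t)
    (hκ.integrable_kernelLp s t)).1
  rwa [hκ.integral_kernelLp] at this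

lemma jumpField_mono (hσ2 : Integrable (fun τ : Ioi (0 : ℝ) => (τ : ℝ) ^ 2) σ)
    (hσ1 : Integrable (fun τ : Ioi (0 : ℝ) => (τ : ℝ)) σ)
    (hν : IsCenteredLevyNoise σ ν) (hκ : IsVolatility κ) (hT : IsPairingExtension ν T)
    {s t s' t' : ℝ} (hs : s ≤ s') (ht : t ≤ t') :
    ∀ᵐ ω ∂ν, jumpField σ hκ T s t ω ≤ jumpField σ hκ T s' t' ω := by
  have hsub := Lp.coeFn_sub (hκ.kernelLp s' t') (hκ.kernelLp s t)
  have hint := (hκ.integrable_kernelLp s' t').sub (hκ.integrable_kernelLp s t)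
  have h := (pairing_nonneg_and_laplace hσ2 hσ1 hν hT (sub_nonneg.2 (hκ.kernelLp_mono hs ht))
    (hint.congr hsub.symm)).1
  rw [integral_congr_ae hsub, integral_sub' (hκ.integrable_kernelLp s' t')
    (hκ.integrable_kernelLp s t), hκ.integral_kernelLp, hκ.integral_kernelLp, map_sub] at h
  filter_upwards [h, Lp.coeFn_sub (T (hκ.kernelLp s' t')) (T (hκ.kernelLp s t))] with ω h1 h2
  rw [h2, Pi.sub_apply, sub_mul] at h1
  simp only [jumpField]
  linarith

end Rates

end LevyTermStructure

theorem corollary2p1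
    -- the Lévy measure on `(0, ∞)`, with finite second and first moments
    (σ : Measure (Ioi (0 : ℝ)))
    (hσ2 : Integrable (fun τ : Ioi (0 : ℝ) => (τ : ℝ) ^ 2) σ)
    (hσ1 : Integrable (fun τ : Ioi (0 : ℝ) => (τ : ℝ)) σ)
    -- the centered Lévy noise measure
    (ν : Measure LevyTermStructure.Dist) [IsProbabilityMeasure ν]
    (hν : LevyTermStructure.IsCenteredLevyNoise σ ν)
    -- `ϰ : [0, ∞)² → [0, ∞)`, measurable and locally bounded
    (κ : ℝ × ℝ → ℝ)
    (hκ_meas : Measurable ((Ici (0 : ℝ) ×ˢ Ici (0 : ℝ)).domRestrict κ))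
    (hκ_nonneg : ∀ x y : ℝ, 0 ≤ x → 0 ≤ y → 0 ≤ κ (x, y))
    (hκ_bdd : ∀ T : ℝ, ∃ C : ℝ, ∀ x ∈ Icc 0 T, ∀ y ∈ Icc 0 T, κ (x, y) ≤ C)
    -- the deterministic continuous term
    (μ : ℝ → ℝ → ℝ)
    (hμ : ContinuousOn (fun p : ℝ × ℝ => μ p.1 p.2) {p | 0 ≤ p.1 ∧ p.1 ≤ p.2})
    -- for each `t`, the discounted bond-price process is a martingale
    (hmart : ∀ t : ℝ, 0 ≤ t →
      Martingale (fun s : Icc (0 : ℝ) t =>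
          LevyTermStructure.discountedBondPrice ν κ μ s t)
        (LevyTermStructure.informationFiltration ν κ μ t) ν)
    -- the condition on the initial term structure
    (hinit : ∀ t : ℝ, 0 ≤ t →
      (∫ y in (0 : ℝ)..t, ∫ x in (0 : ℝ)..t, κ (x, y)) * (∫ τ : Ioi (0 : ℝ), (τ : ℝ) ∂σ)
        ≤ μ 0 t) :
    (∀ s t : ℝ, 0 ≤ s → s ≤ t → ∀ᵐ ω ∂ν, 0 ≤ LevyTermStructure.forwardRate ν κ μ s t ω) ∧
    (∀ t : ℝ, 0 ≤ t → ∀ᵐ ω ∂ν, 0 ≤ LevyTermStructure.spotRate ν κ μ t ω) ∧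
    -- a right-continuous version of the field of forward rates is non-negative at all `(s, t)`
    -- simultaneously, almost surely; in particular so are the spot rates `G t t`
    (∃ G : ℝ → ℝ → LevyTermStructure.Dist → ℝ,
      (∀ s t : ℝ, 0 ≤ s → s ≤ t →
        Measurable (G s t) ∧ G s t =ᵐ[ν] LevyTermStructure.forwardRate ν κ μ s t) ∧
      ∀ᵐ ω ∂ν, ∀ s t : ℝ, 0 ≤ s → s ≤ t →
        0 ≤ G s t ω ∧
        ContinuousWithinAt (fun p : ℝ × ℝ => G p.1 p.2 ω)
          {p | s ≤ p.1 ∧ t ≤ p.2 ∧ p.1 ≤ p.2} (s, t)) := by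
  open LevyTermStructure in
  have hσ : SFinite σ := sFinite_of_integrable hσ1
  have hκ : IsVolatility κ := ⟨hκ_meas, hκ_nonneg, hκ_bdd⟩
  obtain ⟨T, hT⟩ := exists_isPairingExtension hσ2 hν
  set I : ℝ → ℝ → ℝ := fun s t => (∫ z, kernel κ s t z) * ∫ τ : Ioi (0 : ℝ), (τ : ℝ) ∂σ with hI
  -- the forward rate without jumps is nonnegative
  have hdet : ∀ s t, 0 ≤ s → s ≤ t → 0 ≤ μ s t - I s t := by
    intro s t hs hst
    have ht := hs.trans hst
    have h1 := initial_le_mean hσ2 hσ1 hν hκ hT hμ hmart hs hst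
    have h2 := hinit t ht
    rw [← hκ.integral_kernel_eq ht] at h2
    have h3 : I s t ≤ I t t := by
      refine mul_le_mul_of_nonneg_right ?_ (integral_nonneg fun τ => le_of_lt τ.2)
      exact integral_mono (hκ.integrable_kernel s t) (hκ.integrable_kernel t t)
        (hκ.kernel_mono hst le_rfl)
    linarith
  have hF : ∀ s t, forwardRate ν κ μ s t =ᵐ[ν]
      fun ω => μ s t - I s t + jumpField σ hκ T s t ω := by
    intro s t
    filter_upwards [coeFn_forwardRate (μ := μ) hκ hT s t] with ω hω
    rw [hω, jumpField]
    ring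
  have hpos : ∀ s t : ℝ, 0 ≤ s → s ≤ t → ∀ᵐ ω ∂ν, 0 ≤ forwardRate ν κ μ s t ω := by
    intro s t hs hst
    filter_upwards [hF s t, jumpField_nonneg hσ2 hσ1 hν hκ hT s t] with ω h1 h2
    rw [h1]
    exact add_nonneg (hdet s t hs hst) h2
  refine ⟨hpos, fun t ht => hpos t t ht le_rfl,
    fun s t ω => μ s t - I s t + rightInf (jumpField σ hκ T) s t ω, fun s t hs hst => ⟨?_, ?_⟩,
    ae_of_all _ fun ω s t hs hst => ⟨?_, ?_⟩⟩
  · exact (measurable_rightInf (measurable_jumpField hκ) s t).const_add _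
  · have h1 := rightInf_ae_eq (jumpField_nonneg hσ2 hσ1 hν hκ hT s t)
      (fun s' t' hs' ht' => jumpField_mono hσ2 hσ1 hν hκ hT hs' ht')
      (fun q hq => tendstoInMeasure_jumpField hκ hq)
    filter_upwards [hF s t, h1] with ω h2 h3
    rw [h2, h3]
  · exact add_nonneg (hdet s t hs hst) (rightInf_nonneg _ s t ω)
  · refine ContinuousWithinAt.add (ContinuousWithinAt.sub ?_ ?_) ?_
    · exact (hμ (s, t) ⟨hs, hst⟩).mono fun p hp => ⟨hs.trans hp.1, hp.2.2⟩
    · exact (hκ.continuous_integral_kernel.mul continuous_const).continuousWithinAt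
    · exact (continuousWithinAt_rightInf _ s t ω).mono fun p hp => ⟨hp.1, hp.2.1⟩
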